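/- Let $M$ and $\widehat M$ be connected, oriented (smooth) Riemannian manifolds of the same dimension $n$, let $\tau>0$, and let $D/dt$ denote the covariant derivative of the Levi-Civita connection along curves. All derivatives of absolutely continuous curves are understood for almost every $t$. Let $x\colon[0,\tau]\to M$ be absolutely continuous. A *horizontal curve* over $x$ is a family of positively oriented linear isometries $f(t)\colon\mathbb R^n\to T_{x(t)}M$, $t\in[0,\tau]$, such that each $f_j(t)=f(t)(e_j)$ is an absolutely continuous vector field along $x$ with $\frac{D}{dt}f_j=0$ a.e. An *anti-development* of $x$ is an absolutely continuous curve $y\colon[0,\tau]\to\mathbb R^n$ with $y(0)=0$ for which there is a horizontal curve $f$ over $x$ with $f(t)(\dot y(t))=\dot x(t)$ for almost every $t$. The same definitions apply to $\widehat M$. A *rolling along* $(x,\widehat x)$, where $\widehat x\colon[0,\tau]\to\widehat M$ is absolutely continuous too, is an absolutely continuous family of positively oriented linear isometries $q(t)\colon T_{x(t)}M\to T_{\widehat x(t)}\widehat M$, $t\in[0,\tau]$, such that $\dot{\widehat x}(t)=q(t)\dot x(t)$ for almost every $t$ (no slip), and, for every absolutely continuous vector field $Z$ along $x$, $q(t)\frac{D}{dt}Z(t)=\frac{D}{dt}\big(q(t)Z(t)\big)$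 for almost every $t$ (no twist). **Theorem.** Let $x\colon[0,\tau]\to M$ and $\widehat x\colon[0,\tau]\to\widehat M$ be absolutely continuous curves. 1. Let $y$ and $\widehat y$ be any anti-developments of $x$ and $\widehat x$, respectively. Then there is a rolling along $(x,\widehat x)$ if and only if there is $\iota\in\mathrm{SO}(n)$ with $\widehat y(t)=\iota(y(t))$ for all $t\in[0,\tau]$. 2. There is a rolling along $(x,\widehat x)$ if and only if $x$ and $\widehat x$ have the same set of anti-developments. -/

import Mathlib

open Set MeasureTheory Bundle
open scoped Manifold ContDiff Topology

/-! ### Tangent vectors in charts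

Manifolds are modelled on `EuclideanSpace ℝ (Fin n)` through `𝓡 n`, hence have no boundary. -/

noncomputable section

namespace Rolling

section Single

variable {n : ℕ} {M : Type*} [TopologicalSpace M] [ChartedSpace (EuclideanSpace ℝ (Fin n)) M]

/-- The coordinate vector in `ℝⁿ` of a tangent vector `v ∈ T_p M` in the chart `φ`, that is
`dφ_p v`. -/
def tangentCoord (φ : OpenPartialHomeomorph M (EuclideanSpace ℝ (Fin n))) (p : M)
    (v : TangentSpace (𝓡 n) p) : EuclideanSpace ℝ (Fin n) :=
  mfderiv (𝓡 n) (𝓡 n) φ p v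

/-- The tangent vector at `p` with coordinate vector `w` in the chart `φ`, that is
`(dφ_p)⁻¹ w = ∑ i, wᵢ ∂ᵢ`. -/
def ofCoord (φ : OpenPartialHomeomorph M (EuclideanSpace ℝ (Fin n))) (p : M)
    (w : EuclideanSpace ℝ (Fin n)) : TangentSpace (𝓡 n) p :=
  (mfderiv (𝓡 n) (𝓡 n) φ p).inverse w

/-- The `i`-th vector of the standard basis of `ℝⁿ`. -/
abbrev stdVec (i : Fin n) : EuclideanSpace ℝ (Fin n) := EuclideanSpace.single i 1

/-! ### Orientations of manifolds -/

/-- The differential at `p` of a chart `φ` around `p`, as a linear equivalence. -/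
def chartEquiv [IsManifold (𝓡 n) ∞ M]
    {φ : OpenPartialHomeomorph M (EuclideanSpace ℝ (Fin n))}
    (hφ : φ ∈ atlas (EuclideanSpace ℝ (Fin n)) M) {p : M} (hp : p ∈ φ.source) :
    TangentSpace (𝓡 n) p ≃ₗ[ℝ] EuclideanSpace ℝ (Fin n) :=
  ((mdifferentiable_of_mem_atlas (I := 𝓡 n) hφ).mfderiv hp).toLinearEquiv

/-- The linear equivalence `chartEquiv` is `tangentCoord`. -/
theorem chartEquiv_apply [IsManifold (𝓡 n) ∞ M]
    {φ : OpenPartialHomeomorph M (EuclideanSpace ℝ (Fin n))}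
    (hφ : φ ∈ atlas (EuclideanSpace ℝ (Fin n)) M) {p : M} (hp : p ∈ φ.source)
    (v : TangentSpace (𝓡 n) p) : chartEquiv hφ hp v = tangentCoord φ p v := rfl

variable (n M) in
/-- An orientation of the manifold `M`: an orientation of every tangent space that, read in any
chart, is locally constant. -/
structure ManifoldOrientation [IsManifold (𝓡 n) ∞ M] where
  /-- The orientation of each tangent space. -/
  at_ : ∀ p : M, Orientation ℝ (TangentSpace (𝓡 n) p) (Fin n)
  /-- Continuity of the choice of orientation. -/
  locallyConstant : ∀ (φ : OpenPartialHomeomorph M (EuclideanSpace ℝ (Fin n)))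
    (hφ : φ ∈ atlas (EuclideanSpace ℝ (Fin n)) M) (p : M) (hp : p ∈ φ.source),
    ∀ᶠ p' in 𝓝 p, ∀ hp' : p' ∈ φ.source,
      Orientation.map (Fin n) (chartEquiv hφ hp') (at_ p') =
        Orientation.map (Fin n) (chartEquiv hφ hp) (at_ p)

variable (n) in
/-- The standard orientation of `ℝⁿ`. -/
def stdOrientation : Orientation ℝ (EuclideanSpace ℝ (Fin n)) (Fin n) :=
  (EuclideanSpace.basisFun (Fin n) ℝ).toBasis.orientation

/-! ### Absolutely continuous curves and vector fields along them

Curves on `[0, τ]` are given by functions on `ℝ` of which only the values on `[0, τ]` matter. -/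

variable (n) in
/-- `x : [0, τ] → M` is absolutely continuous: it is continuous, and absolutely continuous in
charts. -/
def IsACCurve (τ : ℝ) (x : ℝ → M) : Prop :=
  ContinuousOn x (Icc 0 τ) ∧
    ∀ φ ∈ atlas (EuclideanSpace ℝ (Fin n)) M, ∀ a b : ℝ, a ≤ b → Icc a b ⊆ Icc 0 τ →
      (∀ t ∈ Icc a b, x t ∈ φ.source) →
        AbsolutelyContinuousOnInterval (fun t => φ (x t)) a b

/-- The vector field `Z` along the absolutely continuous curve `x : [0, τ] → M` is absolutely
continuous, i.e. its components in charts are. -/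
def IsACField (τ : ℝ) (x : ℝ → M) (Z : ∀ t : ℝ, TangentSpace (𝓡 n) (x t)) : Prop :=
  ∀ φ ∈ atlas (EuclideanSpace ℝ (Fin n)) M, ∀ a b : ℝ, a ≤ b → Icc a b ⊆ Icc 0 τ →
    (∀ t ∈ Icc a b, x t ∈ φ.source) →
      AbsolutelyContinuousOnInterval (fun t => tangentCoord φ (x t) (Z t)) a b

/-- The velocity `ẋ(t) ∈ T_{x(t)} M`. -/
def velocity (x : ℝ → M) (t : ℝ) : TangentSpace (𝓡 n) (x t) :=
  mfderiv 𝓘(ℝ, ℝ) (𝓡 n) x t (1 : ℝ)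

/-! ### The covariant derivative of the Levi-Civita connection along a curve -/

variable [RiemannianBundle (fun p : M => TangentSpace (𝓡 n) p)]

/-- The matrix `g_{ij} = ⟨∂ᵢ, ∂ⱼ⟩` of the metric in the chart `φ`, as a function of the
coordinates `u`. -/
def metricMatrix (φ : OpenPartialHomeomorph M (EuclideanSpace ℝ (Fin n)))
    (u : EuclideanSpace ℝ (Fin n)) : Matrix (Fin n) (Fin n) ℝ :=
  Matrix.of fun i j =>
    inner ℝ (ofCoord φ (φ.symm u) (stdVec i)) (ofCoord φ (φ.symm u) (stdVec j))

/-- The partial derivative `∂_k g_{ij}`. -/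
def metricPartial (φ : OpenPartialHomeomorph M (EuclideanSpace ℝ (Fin n)))
    (u : EuclideanSpace ℝ (Fin n)) (k i j : Fin n) : ℝ :=
  fderiv ℝ (fun v => metricMatrix φ v i j) u (stdVec k)

/-- The Christoffel symbol
`Γ^k_{ij} = ½ ∑ₗ g^{kl} (∂ᵢ g_{jl} + ∂ⱼ g_{il} - ∂ₗ g_{ij})` of the Levi-Civita connection in the
chart `φ`. -/
def christoffel (φ : OpenPartialHomeomorph M (EuclideanSpace ℝ (Fin n)))
    (u : EuclideanSpace ℝ (Fin n)) (k i j : Fin n) : ℝ :=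
  (1 / 2) * ∑ l, (metricMatrix φ u)⁻¹ k l *
    (metricPartial φ u i j l + metricPartial φ u j i l - metricPartial φ u l i j)

/-- The covariant derivative `D/dt Z` at time `t`, computed in the chart `φ`:
`(D/dt Z)^k = ż^k + ∑ᵢⱼ Γ^k_{ij} ẋ^i z^j`. -/
def covDerivIn (φ : OpenPartialHomeomorph M (EuclideanSpace ℝ (Fin n))) (x : ℝ → M)
    (Z : ∀ t : ℝ, TangentSpace (𝓡 n) (x t)) (t : ℝ) : TangentSpace (𝓡 n) (x t) :=
  ofCoord φ (x t) (WithLp.toLp 2 fun k =>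
    (deriv (fun s => tangentCoord φ (x s) (Z s)) t) k +
      ∑ i, ∑ j, christoffel φ (φ (x t)) k i j *
        (deriv (fun s => φ (x s)) t) i * (tangentCoord φ (x t) (Z t)) j)

/-- The Levi-Civita covariant derivative `D/dt Z` at time `t` of a vector field `Z` along `x`.
It does not depend on the chart around `x t`; the preferred one is used. For absolutely continuous
`x` and `Z` the derivatives in the formula exist for almost every `t`. -/
def covDeriv (x : ℝ → M) (Z : ∀ t : ℝ, TangentSpace (𝓡 n) (x t)) (t : ℝ) :
    TangentSpace (𝓡 n) (x t) :=
  covDerivIn (chartAt (EuclideanSpace ℝ (Fin n)) (x t)) x Z t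

/-- `Z` is a parallel vector field along `x : [0, τ] → M`. -/
def IsParallel (τ : ℝ) (x : ℝ → M) (Z : ∀ t : ℝ, TangentSpace (𝓡 n) (x t)) : Prop :=
  IsACField τ x Z ∧ ∀ᵐ t : ℝ, t ∈ Icc 0 τ → covDeriv x Z t = 0

/-! ### Horizontal curves of frames and anti-developments -/

/-- `f` is a horizontal curve, lying over `x : [0, τ] → M`, in the bundle of positively oriented
orthonormal frames: each `f t : ℝⁿ → T_{x(t)} M` is a positively oriented isometry, and each
`f_j = f(e_j)` is parallel along `x`. -/
structure IsHorizontal [IsManifold (𝓡 n) ∞ M] (o : ManifoldOrientation n M) (τ : ℝ) (x : ℝ → M)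
    (f : ∀ t : ℝ, EuclideanSpace ℝ (Fin n) ≃ₗᵢ[ℝ] TangentSpace (𝓡 n) (x t)) : Prop where
  oriented : ∀ t ∈ Icc 0 τ,
    Orientation.map (Fin n) (f t).toLinearEquiv (stdOrientation n) = o.at_ (x t)
  parallel : ∀ j : Fin n, IsParallel τ x (fun t => f t (stdVec j))

/-- `y : [0, τ] → ℝⁿ` is an anti-development of `x : [0, τ] → M`. -/
def IsAntiDevelopment [IsManifold (𝓡 n) ∞ M] (o : ManifoldOrientation n M) (τ : ℝ) (x : ℝ → M)
    (y : ℝ → EuclideanSpace ℝ (Fin n)) : Prop :=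
  AbsolutelyContinuousOnInterval y 0 τ ∧ y 0 = 0 ∧
    ∃ f : ∀ t : ℝ, EuclideanSpace ℝ (Fin n) ≃ₗᵢ[ℝ] TangentSpace (𝓡 n) (x t),
      IsHorizontal o τ x f ∧ ∀ᵐ t : ℝ, t ∈ Icc 0 τ → f t (deriv y t) = velocity x t

end Single

/-! ### Rollings -/

section Pair

variable {n : ℕ} {M : Type*} [TopologicalSpace M] [ChartedSpace (EuclideanSpace ℝ (Fin n)) M]
  [IsManifold (𝓡 n) ∞ M] [RiemannianBundle (fun p : M => TangentSpace (𝓡 n) p)]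
  {N : Type*} [TopologicalSpace N] [ChartedSpace (EuclideanSpace ℝ (Fin n)) N]
  [IsManifold (𝓡 n) ∞ N] [RiemannianBundle (fun p : N => TangentSpace (𝓡 n) p)]

/-- `q` is an intrinsic rolling of `M` on `N` with projections `x : [0, τ] → M` and
`x' : [0, τ] → N`: an absolutely continuous curve of positively oriented isometries
`q t : T_{x(t)} M → T_{x'(t)} N` without slipping and twisting. -/
structure IsRolling (o : ManifoldOrientation n M) (o' : ManifoldOrientation n N) (τ : ℝ)
    (x : ℝ → M) (x' : ℝ → N)
    (q : ∀ t : ℝ, TangentSpace (𝓡 n) (x t) ≃ₗᵢ[ℝ] TangentSpace (𝓡 n) (x' t)) : Prop where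
  curve : IsACCurve n τ x
  curve' : IsACCurve n τ x'
  oriented : ∀ t ∈ Icc 0 τ,
    Orientation.map (Fin n) (q t).toLinearEquiv (o.at_ (x t)) = o'.at_ (x' t)
  /-- The matrix of `q`, with respect to charts of `M` and `N`, is absolutely continuous. -/
  absolutelyContinuous : ∀ φ ∈ atlas (EuclideanSpace ℝ (Fin n)) M,
    ∀ ψ ∈ atlas (EuclideanSpace ℝ (Fin n)) N, ∀ a b : ℝ, a ≤ b → Icc a b ⊆ Icc 0 τ →
      (∀ t ∈ Icc a b, x t ∈ φ.source ∧ x' t ∈ ψ.source) → ∀ j : Fin n,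
        AbsolutelyContinuousOnInterval
          (fun t => tangentCoord ψ (x' t) (q t (ofCoord φ (x t) (stdVec j)))) a b
  noSlip : ∀ᵐ t : ℝ, t ∈ Icc 0 τ → velocity x' t = q t (velocity x t)
  noTwist : ∀ Z : (∀ t : ℝ, TangentSpace (𝓡 n) (x t)), IsACField τ x Z →
    ∀ᵐ t : ℝ, t ∈ Icc 0 τ → q t (covDeriv x Z t) = covDeriv x' (fun s => q s (Z s)) t

end Pair

end Rolling

end

/-! A rolling amounts to a pair of parallel orthonormal frames in which the two velocities have
equal components. If `f` is parallel along `x` and `q` rolls, then no twist makes `q ∘ f` parallel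
along `x'`, and no slip says that `q ∘ f` reads the velocity of `x'` as `f` reads that of `x`
(`IsRolling.isHorizontal`, `IsRolling.isAntiDevelopment`). Conversely, parallel frames `f` and `F`
reading the velocities equally give the rolling `F ∘ f⁻¹` (`isRolling_of_frames`): the components of
`Z` in `f` and of its image in `F` are the same functions, and differentiating them compares the
covariant derivatives.

For the first claim, two parallel frames over one curve differ by a constant isometry
(`parallel_frame_eq`). Hence a rolling relates the derivatives of `y` and `y'` by a constant
rotation, and the curves themselves because both start at 0. Conversely, a rotation relating them
can be absorbed into the frame along `x'`. For the second claim, a rolling and its inverse transport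
anti-developments in both directions, while a common anti-development is the first claim with the
identity rotation.

The analysis underneath is parallel transport along absolutely continuous curves. In a chart it is a
linear equation with merely integrable coefficients, solved by Picard iteration on short intervals
and glued (`exists_linear_integral_eq`, `exists_parallel_frame`). Independence of the chart follows
from the transformation law of the Christoffel symbols (`christoffelMap_coordChange`), and metric
compatibility (`hasDerivAt_inner`) makes inner products of parallel fields constant, which gives
orthonormality and uniqueness of frames.

Dimension 0 needs care: its only isometry cannot reverse an orientation, so a curve may have no
positively oriented frame and no anti-development at all. Rollings are therefore built from frames
matched to any common orientation `σ` of `ℝⁿ`. -/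

set_option synthInstance.maxHeartbeats 400000

/-! ### Absolutely continuous functions -/

/-- A property of subintervals that can be glued and that holds locally holds globally. -/
theorem Rolling.interval_induction {a b : ℝ} (hab : a ≤ b) (P : ℝ → ℝ → Prop)
    (glue : ∀ c d e, a ≤ c → c ≤ d → d ≤ e → e ≤ b → P c d → P d e → P c e)
    (loc : ∀ t ∈ Icc a b, ∃ U ∈ 𝓝 t, ∀ c d, c ≤ d → Icc c d ⊆ Icc a b → Icc c d ⊆ U → P c d) :
    P a b := by
  choose! U hU hP using loc
  obtain ⟨δ, hδ, H⟩ := lebesgue_number_lemma_of_metric (c := fun t : Icc a b => interior (U t))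
    (isCompact_Icc (a := a) (b := b)) (fun _ => isOpen_interior)
    (fun t ht => mem_iUnion.2 ⟨⟨t, ht⟩, mem_interior_iff_mem_nhds.2 (hU t ht)⟩)
  -- An interval of length at most `δ / 2` lies in the open `δ`-ball about either endpoint, hence in
  -- one set of the cover. Longer ones are cut at distance `δ / 2` from the right end, and `n`
  -- bounds the number of cuts.
  have step : ∀ n : ℕ, ∀ c d, a ≤ c → c ≤ d → d ≤ b → d - c ≤ (n + 1) * (δ / 2) → P c d := by
    intro n
    induction n with
    | zero =>
      intro c d hac hcd hdb h
      obtain ⟨i, hi⟩ := H c ⟨hac, hcd.trans hdb⟩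
      refine hP i i.2 c d hcd (Icc_subset_Icc hac hdb) fun s hs => interior_subset (hi ?_)
      rw [Metric.mem_ball, Real.dist_eq, abs_of_nonneg (by linarith [hs.1])]
      norm_num at h
      linarith [hs.2]
    | succ n ih =>
      intro c d hac hcd hdb h
      push_cast at h
      by_cases h' : d - c ≤ (n + 1) * (δ / 2)
      · exact ih c d hac hcd hdb h'
      · have h0 : 0 ≤ (n : ℝ) * (δ / 2) := by positivity
        have hpos : c ≤ d - δ / 2 := by nlinarith
        refine glue c (d - δ / 2) d hac hpos (by linarith) hdb
          (ih _ _ hac hpos (by linarith) (by nlinarith)) ?_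
        obtain ⟨i, hi⟩ := H d ⟨hac.trans hcd, hdb⟩
        refine hP i i.2 _ d (by linarith) (Icc_subset_Icc (by linarith) hdb)
          fun s hs => interior_subset (hi ?_)
        rw [Metric.mem_ball, Real.dist_eq, abs_sub_comm, abs_of_nonneg (by linarith [hs.2])]
        linarith [hs.1]
  obtain ⟨n, hn⟩ := exists_nat_ge ((b - a) / (δ / 2))
  refine step n a b le_rfl hab le_rfl ?_
  rw [div_le_iff₀ (by positivity)] at hn
  nlinarith

namespace AbsolutelyContinuousOnInterval

section Metric

variable {X Y : Type*} [PseudoMetricSpace X] [PseudoMetricSpace Y] {a b c : ℝ}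

theorem const_fun (p : X) (a b : ℝ) : AbsolutelyContinuousOnInterval (fun _ => p) a b := by
  rw [absolutelyContinuousOnInterval_iff]
  exact fun ε hε => ⟨1, one_pos, fun E _ _ => by simpa using hε⟩

theorem congr {f g : ℝ → X} (hf : AbsolutelyContinuousOnInterval f a b)
    (h : ∀ t ∈ uIcc a b, f t = g t) : AbsolutelyContinuousOnInterval g a b := by
  rw [absolutelyContinuousOnInterval_iff] at hf ⊢
  intro ε hε
  obtain ⟨δ, hδ, H⟩ := hf ε hε
  refine ⟨δ, hδ, fun E hE hE' => ?_⟩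
  convert! H E hE hE' using 1
  refine Finset.sum_congr rfl fun i hi => ?_
  rw [h _ (hE.1 i hi).1, h _ (hE.1 i hi).2]

theorem comp_lipschitzOnWith {f : ℝ → X} {g : X → Y} {K : NNReal} {s : Set X}
    (hf : AbsolutelyContinuousOnInterval f a b) (hg : LipschitzOnWith K g s)
    (hs : MapsTo f (uIcc a b) s) : AbsolutelyContinuousOnInterval (fun t => g (f t)) a b := by
  rw [absolutelyContinuousOnInterval_iff] at hf ⊢
  intro ε hε
  -- `K + 1` in place of `K` covers the case `K = 0`.
  obtain ⟨δ, hδ, H⟩ := hf (ε / (K + 1)) (by positivity)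
  refine ⟨δ, hδ, fun E hE hE' => ?_⟩
  have h1 := H E hE hE'
  calc _ ≤ ∑ i ∈ Finset.range E.1, (K : ℝ) * dist (f (E.2 i).1) (f (E.2 i).2) :=
        Finset.sum_le_sum fun i hi =>
          hg.dist_le_mul _ (hs (hE.1 i hi).1) _ (hs (hE.1 i hi).2)
    _ = K * ∑ i ∈ Finset.range E.1, dist (f (E.2 i).1) (f (E.2 i).2) := by rw [Finset.mul_sum]
    _ ≤ (K + 1) * ∑ i ∈ Finset.range E.1, dist (f (E.2 i).1) (f (E.2 i).2) := by
        gcongr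
        linarith
    _ < ε := by
        rw [lt_div_iff₀ (by positivity)] at h1
        linarith

theorem prodMk {f : ℝ → X} {g : ℝ → Y} (hf : AbsolutelyContinuousOnInterval f a b)
    (hg : AbsolutelyContinuousOnInterval g a b) :
    AbsolutelyContinuousOnInterval (fun t => (f t, g t)) a b := by
  rw [absolutelyContinuousOnInterval_iff] at hf hg ⊢
  intro ε hε
  obtain ⟨δ, hδ, H⟩ := hf (ε / 2) (by positivity)
  obtain ⟨δ', hδ', H'⟩ := hg (ε / 2) (by positivity)
  refine ⟨min δ δ', lt_min hδ hδ', fun E hE hE' => ?_⟩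
  have h1 := H E hE (hE'.trans_le (min_le_left _ _))
  have h2 := H' E hE (hE'.trans_le (min_le_right _ _))
  refine lt_of_le_of_lt ?_ ((add_lt_add h1 h2).trans_eq (add_halves ε))
  rw [← Finset.sum_add_distrib]
  refine Finset.sum_le_sum fun i _ => ?_
  rw [Prod.dist_eq]
  exact max_le (le_add_of_nonneg_right dist_nonneg) (le_add_of_nonneg_left dist_nonneg)

/-- Clamping at `b` from above or from below is 1-Lipschitz and keeps subintervals disjoint, so each
half receives an admissible family. A subinterval straddling `b` is split there by the triangle
inequality. -/
theorem trans {f : ℝ → X} (hf : AbsolutelyContinuousOnInterval f a b)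
    (hf' : AbsolutelyContinuousOnInterval f b c) (hab : a ≤ b) (hbc : b ≤ c) :
    AbsolutelyContinuousOnInterval f a c := by
  rw [absolutelyContinuousOnInterval_iff] at hf hf' ⊢
  intro ε hε
  obtain ⟨δ, hδ, H⟩ := hf (ε / 2) (by positivity)
  obtain ⟨δ', hδ', H'⟩ := hf' (ε / 2) (by positivity)
  refine ⟨min δ δ', lt_min hδ hδ', fun E hE hE' => ?_⟩
  obtain ⟨hE1, hE2⟩ := hE
  rw [uIcc_of_le (hab.trans hbc)] at hE1
  have d1 : ∀ p q : ℝ, dist (min p b) (min q b) ≤ dist p q := fun p q => by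
    simpa [Real.dist_eq] using abs_min_sub_min_le_max p b q b
  have d2 : ∀ p q : ℝ, dist (max p b) (max q b) ≤ dist p q := fun p q => by
    simpa [Real.dist_eq] using abs_max_sub_max_le_max p b q b
  have h1 := H (E.1, fun i => (min (E.2 i).1 b, min (E.2 i).2 b)) ⟨fun i hi => by
      rw [uIcc_of_le hab]
      exact ⟨⟨le_min (hE1 i hi).1.1 hab, min_le_right _ _⟩,
        ⟨le_min (hE1 i hi).2.1 hab, min_le_right _ _⟩⟩, fun i hi j hj hij => by
      refine (hE2 hi hj hij).mono ?_ ?_ <;>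
      · intro s hs
        simp only [mem_uIoc] at hs ⊢
        grind⟩
    ((Finset.sum_le_sum fun i _ => d1 _ _).trans_lt (hE'.trans_le (min_le_left _ _)))
  have h2 := H' (E.1, fun i => (max (E.2 i).1 b, max (E.2 i).2 b)) ⟨fun i hi => by
      rw [uIcc_of_le hbc]
      exact ⟨⟨le_max_right _ _, max_le (hE1 i hi).1.2 hbc⟩,
        ⟨le_max_right _ _, max_le (hE1 i hi).2.2 hbc⟩⟩, fun i hi j hj hij => by
      refine (hE2 hi hj hij).mono ?_ ?_ <;>
      · intro s hs
        simp only [mem_uIoc] at hs ⊢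
        grind⟩
    ((Finset.sum_le_sum fun i _ => d2 _ _).trans_lt (hE'.trans_le (min_le_right _ _)))
  refine lt_of_le_of_lt ?_ ((add_lt_add h1 h2).trans_eq (add_halves ε))
  rw [← Finset.sum_add_distrib]
  refine Finset.sum_le_sum fun i _ => ?_
  simp only
  rcases le_total (E.2 i).1 b with h | h <;> rcases le_total (E.2 i).2 b with h' | h' <;>
    simp [h, h', dist_comm, dist_triangle_left, add_comm]

theorem of_local {f : ℝ → X} (hab : a ≤ b)
    (h : ∀ t ∈ Icc a b, ∃ U ∈ 𝓝 t, ∀ c d, c ≤ d → Icc c d ⊆ Icc a b → Icc c d ⊆ U →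
      AbsolutelyContinuousOnInterval f c d) : AbsolutelyContinuousOnInterval f a b :=
  Rolling.interval_induction hab _ (fun _ _ _ _ hcd hde _ h1 h2 => h1.trans h2 hcd hde) h

end Metric

section Normed

variable {F G : Type*} [NormedAddCommGroup F] [NormedAddCommGroup G] {a b : ℝ}

theorem finset_sum {ι : Type*} (s : Finset ι) {f : ι → ℝ → F}
    (h : ∀ i ∈ s, AbsolutelyContinuousOnInterval (f i) a b) :
    AbsolutelyContinuousOnInterval (fun t => ∑ i ∈ s, f i t) a b := by
  classical
  induction s using Finset.induction_on with
  | empty => simpa using const_fun (0 : F) a b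
  | insert i s hi ih =>
    simp only [Finset.sum_insert hi]
    exact (h i (Finset.mem_insert_self i s)).add (ih fun j hj => h j (Finset.mem_insert_of_mem hj))

variable [NormedSpace ℝ F] [NormedSpace ℝ G]

/-- A C¹ map is only locally Lipschitz, so the Lipschitz composition is applied on short intervals
and the results are glued. -/
theorem comp_contDiffOn {f : ℝ → F} {g : F → G} {s : Set F} (hab : a ≤ b)
    (hf : AbsolutelyContinuousOnInterval f a b) (hs : IsOpen s) (hg : ContDiffOn ℝ 1 g s)
    (hfs : ∀ t ∈ Icc a b, f t ∈ s) : AbsolutelyContinuousOnInterval (fun t => g (f t)) a b := by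
  refine of_local hab fun t ht => ?_
  obtain ⟨K, V, hV, hK⟩ := (hg.contDiffAt (hs.mem_nhds (hfs t ht))).exists_lipschitzOnWith
  have hc : ContinuousOn f (Icc a b) := by simpa [uIcc_of_le hab] using hf.continuousOn
  obtain ⟨U, hU, hUV⟩ := mem_nhdsWithin_iff_exists_mem_nhds_inter.1 (hc t ht hV)
  refine ⟨U, hU, fun c d hcd h1 h2 => ?_⟩
  refine (hf.mono ?_).comp_lipschitzOnWith hK ?_
  · rwa [uIcc_of_le hab, uIcc_of_le hcd]
  · rw [uIcc_of_le hcd]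
    exact fun s hs => hUV ⟨h2 hs, h1 hs⟩

theorem clm_comp {f : ℝ → F} (L : F →L[ℝ] G) (hf : AbsolutelyContinuousOnInterval f a b) :
    AbsolutelyContinuousOnInterval (fun t => L (f t)) a b :=
  hf.comp_lipschitzOnWith (L.lipschitz.lipschitzOnWith (s := univ)) (mapsTo_univ _ _)

end Normed

section Euclidean

variable {n : ℕ} {a b : ℝ}

theorem coord {f : ℝ → EuclideanSpace ℝ (Fin n)} (hf : AbsolutelyContinuousOnInterval f a b)
    (i : Fin n) : AbsolutelyContinuousOnInterval (fun t => f t i) a b :=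
  hf.clm_comp (EuclideanSpace.proj i : EuclideanSpace ℝ (Fin n) →L[ℝ] ℝ)

theorem of_coord {f : ℝ → EuclideanSpace ℝ (Fin n)}
    (hf : ∀ i, AbsolutelyContinuousOnInterval (fun t => f t i) a b) :
    AbsolutelyContinuousOnInterval f a b := by
  have h := finset_sum Finset.univ fun i _ =>
    (hf i).fun_smul (const_fun (EuclideanSpace.single i (1 : ℝ)) a b)
  refine h.congr fun t _ => ?_
  have := (EuclideanSpace.basisFun (Fin n) ℝ).sum_repr (f t)
  simpa using this

theorem ae_differentiableAt_euclidean {f : ℝ → EuclideanSpace ℝ (Fin n)}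
    (hf : AbsolutelyContinuousOnInterval f a b) :
    ∀ᵐ t : ℝ, t ∈ uIcc a b → DifferentiableAt ℝ f t :=
  hf.boundedVariationOn.ae_differentiableAt_of_mem_uIcc

/-- Coordinatewise reduction to real functions: wherever `f` is differentiable, hence almost
everywhere, its derivative is assembled from those of its coordinates. -/
theorem intervalIntegrable_deriv_euclidean {f : ℝ → EuclideanSpace ℝ (Fin n)}
    (hf : AbsolutelyContinuousOnInterval f a b) : IntervalIntegrable (deriv f) volume a b := by
  have h : IntervalIntegrable
      (fun t => ∑ i, deriv (fun s => f s i) t • EuclideanSpace.single i (1 : ℝ)) volume a b := by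
    have := IntervalIntegrable.sum (μ := volume) (a := a) (b := b) Finset.univ
      (f := fun i t => deriv (fun s => f s i) t • EuclideanSpace.single i (1 : ℝ)) fun i _ =>
        ⟨(hf.coord i).intervalIntegrable_deriv.1.smul_const _,
          (hf.coord i).intervalIntegrable_deriv.2.smul_const _⟩
    simpa only [Finset.sum_fn] using this
  refine h.congr_ae ?_
  rw [Filter.EventuallyEq, ae_restrict_iff' measurableSet_uIoc]
  filter_upwards [hf.ae_differentiableAt_euclidean] with t ht h
  have hd := (ht (uIoc_subset_uIcc h)).hasDerivAt
  have hi : ∀ i, deriv (fun s => f s i) t = deriv f t i := fun i =>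
    ((EuclideanSpace.proj i : EuclideanSpace ℝ (Fin n) →L[ℝ] ℝ).hasFDerivAt.comp_hasDerivAt t
      hd).deriv
  simp only [hi]
  simpa using (EuclideanSpace.basisFun (Fin n) ℝ).sum_repr (deriv f t)

theorem _root_.IntervalIntegrable.absolutelyContinuousOnInterval_integral_euclidean
    {f : ℝ → EuclideanSpace ℝ (Fin n)} (hf : IntervalIntegrable f volume a b) :
    AbsolutelyContinuousOnInterval (fun t => ∫ s in a..t, f s) a b := by
  refine of_coord fun i => ?_
  have hi : IntervalIntegrable (fun s => f s i) volume a b :=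
    ⟨(EuclideanSpace.proj i : EuclideanSpace ℝ (Fin n) →L[ℝ] ℝ).integrable_comp hf.1,
      (EuclideanSpace.proj i : EuclideanSpace ℝ (Fin n) →L[ℝ] ℝ).integrable_comp hf.2⟩
  refine (hi.absolutelyContinuousOnInterval_intervalIntegral left_mem_uIcc).congr fun t ht => ?_
  refine (EuclideanSpace.proj i : EuclideanSpace ℝ (Fin n) →L[ℝ] ℝ).intervalIntegral_comp_comm ?_
  exact hf.mono_set (uIcc_subset_uIcc left_mem_uIcc ht)

end Euclidean

/-- The rigidity behind both uniqueness statements: it is applied to inner products of parallel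
fields and to the difference of an anti-development and a rotated one. -/
theorem eq_of_ae_hasDerivAt_zero {F : Type*} [NormedAddCommGroup F] [NormedSpace ℝ F] {a b : ℝ}
    {f : ℝ → F} (hab : a ≤ b) (hf : AbsolutelyContinuousOnInterval f a b)
    (h : ∀ᵐ t : ℝ, t ∈ Icc a b → HasDerivAt f 0 t) {t : ℝ} (ht : t ∈ Icc a b) : f t = f a := by
  rw [← uIcc_of_le hab] at h ht
  obtain ⟨C, hC⟩ := hf.const_of_ae_hasDerivAt_zero h
  rw [hC t ht, hC a left_mem_uIcc]

end AbsolutelyContinuousOnInterval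

/-! ### Linear differential equations with integrable coefficients -/

namespace Rolling

variable {E : Type*} [NormedAddCommGroup E] [NormedSpace ℝ E]

theorem integrable_clm_apply_of_bounded {A : ℝ → E →L[ℝ] E} {z : ℝ → E} {μ : Measure ℝ}
    (hA : Integrable A μ) (hz : AEStronglyMeasurable z μ) {C : ℝ} (hC : ∀ᵐ t ∂μ, ‖z t‖ ≤ C) :
    Integrable (fun t => A t (z t)) μ := by
  refine Integrable.mono' (hA.norm.mul_const C) ?_ ?_
  · exact (ContinuousLinearMap.id ℝ (E →L[ℝ] E)).aestronglyMeasurable_comp₂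
      hA.aestronglyMeasurable hz
  · filter_upwards [hC] with t ht
    exact (A t).le_opNorm_of_le ht

theorem integrableOn_clm_apply {A : ℝ → E →L[ℝ] E} {z : ℝ → E} {a b : ℝ}
    (hA : IntegrableOn A (Icc a b)) (hz : ContinuousOn z (Icc a b)) :
    IntegrableOn (fun t => A t (z t)) (Icc a b) := by
  obtain ⟨C, hC⟩ := isCompact_Icc.exists_bound_of_continuousOn hz
  exact integrable_clm_apply_of_bounded hA (hz.aestronglyMeasurable measurableSet_Icc)
    ((ae_restrict_iff' measurableSet_Icc).2 (Filter.Eventually.of_forall hC))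

/-- Extension by zero lets the fixed point argument run on bounded continuous functions on the whole
line. -/
theorem exists_integrable_extension {G : Type*} [NormedAddCommGroup G] {A : ℝ → G} {a b : ℝ}
    (hA : IntegrableOn A (Icc a b)) : ∃ B : ℝ → G, Integrable B ∧ (∀ t ∈ Icc a b, B t = A t) ∧
      ∫ t, ‖B t‖ = ∫ t in Icc a b, ‖A t‖ := by
  refine ⟨(Icc a b).indicator A, hA.integrable_indicator measurableSet_Icc,
    fun t ht => indicator_of_mem ht _, ?_⟩
  simp only [norm_indicator_eq_indicator_norm]
  exact integral_indicator measurableSet_Icc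

theorem intervalIntegrable_clm_apply {A : ℝ → E →L[ℝ] E} {z : ℝ → E}
    (hA : Integrable A) (hz : Continuous z) (a b : ℝ) :
    IntervalIntegrable (fun t => A t (z t)) volume a b := by
  rw [intervalIntegrable_iff']
  exact integrableOn_clm_apply hA.integrableOn hz.continuousOn

/-- Picard's theorem for a linear equation whose coefficient has small integral. -/
theorem exists_linear_integral_eq_of_small [CompleteSpace E] {A : ℝ → E →L[ℝ] E}
    (hA : Integrable A) (hs : ∫ t, ‖A t‖ ≤ 1 / 2) (c : ℝ) (z₀ : E) :
    ∃ z : ℝ → E, Continuous z ∧ ∀ t, z t = z₀ + ∫ s in c..t, A s (z s) := by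
  have hint : ∀ z : BoundedContinuousFunction ℝ E, Integrable (fun t => A t (z t)) := fun z =>
    integrable_clm_apply_of_bounded hA z.continuous.aestronglyMeasurable
      (Filter.Eventually.of_forall z.norm_coe_le_norm)
  have hbd : ∀ (z : BoundedContinuousFunction ℝ E) (t : ℝ),
      ‖∫ s in c..t, A s (z s)‖ ≤ 1 / 2 * ‖z‖ := by
    intro z t
    calc _ ≤ ∫ s in uIoc c t, ‖A s (z s)‖ := intervalIntegral.norm_integral_le_integral_norm_uIoc
      _ ≤ ∫ s, ‖A s (z s)‖ :=
        setIntegral_le_integral (hint z).norm (Filter.Eventually.of_forall fun _ => norm_nonneg _)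
      _ ≤ ∫ s, ‖A s‖ * ‖z‖ := integral_mono (hint z).norm (hA.norm.mul_const _)
        fun s => (A s).le_opNorm_of_le (z.norm_coe_le_norm s)
      _ = (∫ s, ‖A s‖) * ‖z‖ := integral_mul_const _ _
      _ ≤ 1 / 2 * ‖z‖ := by gcongr
  -- The Picard operator. The bound `hbd`, applied to a difference by linearity, makes it a
  -- contraction with constant 1/2.
  let T : BoundedContinuousFunction ℝ E → BoundedContinuousFunction ℝ E := fun z =>
    BoundedContinuousFunction.ofNormedAddCommGroup (fun t => z₀ + ∫ s in c..t, A s (z s))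
      (continuous_const.add
        (intervalIntegral.continuous_primitive (fun a b => (hint z).intervalIntegrable) c))
      (‖z₀‖ + 1 / 2 * ‖z‖) fun t => (norm_add_le _ _).trans (by gcongr; exact hbd z t)
  have hT : ContractingWith (1 / 2) T := by
    refine ⟨by rw [← NNReal.coe_lt_coe]; norm_num, LipschitzWith.of_dist_le_mul fun z w => ?_⟩
    rw [BoundedContinuousFunction.dist_le (by positivity)]
    intro t
    have h1 : T z t - T w t = ∫ s in c..t, A s ((z - w) s) := by
      simp only [T, BoundedContinuousFunction.coe_ofNormedAddCommGroup,
        BoundedContinuousFunction.coe_sub, Pi.sub_apply, map_sub]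
      rw [intervalIntegral.integral_sub (hint z).intervalIntegrable (hint w).intervalIntegrable]
      abel
    rw [dist_eq_norm, h1, dist_eq_norm]
    simpa using hbd (z - w) t
  refine ⟨hT.fixedPoint, (hT.fixedPoint).continuous, fun t => ?_⟩
  have h := congrArg (fun z : BoundedContinuousFunction ℝ E => z t) hT.fixedPoint_isFixedPt
  exact h.symm

/-- A linear differential equation with integrable coefficient has a solution, in the sense of
integral equations, with any given initial value. -/
theorem exists_linear_integral_eq [CompleteSpace E] {A : ℝ → E →L[ℝ] E} {a b : ℝ} (hab : a ≤ b)
    (hA : IntegrableOn A (Icc a b)) (z₀ : E) :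
    ∃ z : ℝ → E, Continuous z ∧ ∀ t ∈ Icc a b, z t = z₀ + ∫ s in a..t, A s (z s) := by
  suffices H : ∀ A : ℝ → E →L[ℝ] E, Integrable A → ∀ z₀ : E,
      ∃ z : ℝ → E, Continuous z ∧ ∀ t ∈ Icc a b, z t = z₀ + ∫ s in a..t, A s (z s) by
    obtain ⟨B, hB, hBA, -⟩ := exists_integrable_extension hA
    obtain ⟨z, hz, hz'⟩ := H B hB z₀
    refine ⟨z, hz, fun t ht => (hz' t ht).trans ?_⟩
    congr 1
    refine intervalIntegral.integral_congr fun s hs => ?_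
    rw [uIcc_of_le ht.1] at hs
    simp only [hBA s ⟨hs.1, hs.2.trans ht.2⟩]
  intro A hA
  -- All initial values are allowed, so that gluing can restart from the endpoint of the previous
  -- solution.
  refine interval_induction hab (fun c d => ∀ z₀ : E,
      ∃ z : ℝ → E, Continuous z ∧ ∀ t ∈ Icc c d, z t = z₀ + ∫ s in c..t, A s (z s)) ?_ ?_
  · intro c d e _ hcd hde _ h1 h2 z₀
    obtain ⟨z, hz, hz'⟩ := h1 z₀
    obtain ⟨w, hw, hw'⟩ := h2 (z d)
    have hwd : w d = z d := by simpa using hw' d ⟨le_rfl, hde⟩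
    have h3 : ∀ t ∈ Icc c d, (∫ s in c..t, A s (if s ≤ d then z s else w s)) =
        ∫ s in c..t, A s (z s) := by
      intro t ht
      refine intervalIntegral.integral_congr fun s hs => ?_
      rw [uIcc_of_le ht.1] at hs
      simp [hs.2.trans ht.2]
    have hc : Continuous fun t => if t ≤ d then z t else w t :=
      Continuous.if_le hz hw continuous_id continuous_const fun t ht => by rw [ht, hwd]
    refine ⟨fun t => if t ≤ d then z t else w t, hc, fun t ht => ?_⟩
    simp only
    by_cases htd : t ≤ d
    · rw [if_pos htd, h3 t ⟨ht.1, htd⟩]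
      exact hz' t ⟨ht.1, htd⟩
    · rw [if_neg htd, hw' t ⟨(not_le.1 htd).le, ht.2⟩, hz' d ⟨hcd, le_rfl⟩,
        ← intervalIntegral.integral_add_adjacent_intervals
          (intervalIntegrable_clm_apply hA hc c d) (intervalIntegrable_clm_apply hA hc d t),
        h3 d ⟨hcd, le_rfl⟩, add_assoc]
      congr 2
      refine intervalIntegral.integral_congr fun s hs => ?_
      rw [uIcc_of_le (not_le.1 htd).le] at hs
      rcases hs.1.eq_or_lt with h | h
      · simp [← h, hwd]
      · simp [not_le.2 h]
  · intro t _
    have hF : Continuous fun t => ∫ s in a..t, ‖A s‖ :=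
      intervalIntegral.continuous_primitive (fun a b => hA.norm.intervalIntegrable) a
    -- With the primitive of `‖A‖` within 1/4 of its value at `t`, its increment over `[c, d]` is at
    -- most 1/2, as Picard iteration requires.
    refine ⟨_, hF.continuousAt.preimage_mem_nhds (Metric.ball_mem_nhds _ (ε := 1 / 4) (by norm_num)),
      fun c d hcd _ hU z₀ => ?_⟩
    obtain ⟨B, hB, hBA, hBn⟩ := exists_integrable_extension (hA.integrableOn (s := Icc c d))
    have hs : ∫ t, ‖B t‖ ≤ 1 / 2 := by
      have h1 := hU ⟨le_rfl, hcd⟩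
      have h2 := hU ⟨hcd, le_rfl⟩
      simp only [mem_preimage, Metric.mem_ball, Real.dist_eq, abs_lt] at h1 h2
      rw [hBn, integral_Icc_eq_integral_Ioc,
        ← intervalIntegral.integral_of_le hcd, ← intervalIntegral.integral_interval_sub_left
          hA.norm.intervalIntegrable hA.norm.intervalIntegrable (a := a)]
      linarith [h1.1, h2.2]
    obtain ⟨z, hz, hz'⟩ := exists_linear_integral_eq_of_small hB hs c z₀
    refine ⟨z, hz, fun t ht => (hz' t).trans ?_⟩
    congr 1
    refine intervalIntegral.integral_congr fun s hs => ?_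
    rw [uIcc_of_le ht.1] at hs
    simp only [hBA s ⟨hs.1, hs.2.trans ht.2⟩]

end Rolling

/-! ### Charts, their transition maps, and the metric in charts -/

namespace Rolling

/-- The model space `ℝⁿ`. -/
abbrev Euc (n : ℕ) := EuclideanSpace ℝ (Fin n)

theorem sum_coord_smul_stdVec {n : ℕ} (v : Euc n) : ∑ i, v i • stdVec i = v := by
  simpa using (EuclideanSpace.basisFun (Fin n) ℝ).sum_repr v

section Charts

variable {n : ℕ} {M : Type*} [TopologicalSpace M] [ChartedSpace (Euc n) M]
  [IsManifold (𝓡 n) ∞ M] {φ ψ : OpenPartialHomeomorph M (Euc n)} {p : M}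

/-- `ContinuousLinearMap.inverse` is zero at maps that are not invertible; on the source of the
chart the differential is invertible, so `ofCoord` is a genuine inverse there. -/
theorem ofCoord_eq_chartEquiv_symm (hφ : φ ∈ atlas (Euc n) M) (hp : p ∈ φ.source) (w : Euc n) :
    ofCoord φ p w = (chartEquiv hφ hp).symm w := by
  have h : mfderiv (𝓡 n) (𝓡 n) φ p =
      (((mdifferentiable_of_mem_atlas (I := 𝓡 n) hφ).mfderiv hp : _ ≃L[ℝ] _) : _ →L[ℝ] _) := rfl
  unfold ofCoord
  rw [h, ContinuousLinearMap.inverse_equiv]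
  rfl

theorem ofCoord_tangentCoord (hφ : φ ∈ atlas (Euc n) M) (hp : p ∈ φ.source)
    (v : TangentSpace (𝓡 n) p) : ofCoord φ p (tangentCoord φ p v) = v := by
  rw [ofCoord_eq_chartEquiv_symm hφ hp, ← chartEquiv_apply hφ hp, LinearEquiv.symm_apply_apply]

theorem tangentCoord_ofCoord (hφ : φ ∈ atlas (Euc n) M) (hp : p ∈ φ.source) (w : Euc n) :
    tangentCoord φ p (ofCoord φ p w) = w := by
  rw [ofCoord_eq_chartEquiv_symm hφ hp, ← chartEquiv_apply hφ hp, LinearEquiv.apply_symm_apply]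

/-- The coordinate change from `φ` to `ψ`. -/
def coordChange (φ ψ : OpenPartialHomeomorph M (Euc n)) (u : Euc n) : Euc n := ψ (φ.symm u)

theorem contDiffOn_coordChange (hφ : φ ∈ atlas (Euc n) M) (hψ : ψ ∈ atlas (Euc n) M) :
    ContDiffOn ℝ ∞ (coordChange φ ψ) (φ.symm.trans ψ).source := by
  rw [← contMDiffOn_iff_contDiffOn]
  have h1 := contMDiffOn_of_mem_maximalAtlas (I := 𝓡 n) (n := ∞)
    (IsManifold.subset_maximalAtlas hψ)
  have h2 := contMDiffOn_symm_of_mem_maximalAtlas (I := 𝓡 n) (n := ∞)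
    (IsManifold.subset_maximalAtlas hφ)
  exact h1.comp (h2.mono fun u hu => hu.1) fun u hu => hu.2

theorem contDiffAt_coordChange (hφ : φ ∈ atlas (Euc n) M) (hψ : ψ ∈ atlas (Euc n) M)
    (hp : p ∈ φ.source) (hp' : p ∈ ψ.source) : ContDiffAt ℝ ∞ (coordChange φ ψ) (φ p) :=
  (contDiffOn_coordChange hφ hψ).contDiffAt
    ((φ.symm.trans ψ).open_source.mem_nhds ⟨φ.map_source hp, by simpa [hp] using hp'⟩)

omit [ChartedSpace (Euc n) M] [IsManifold (𝓡 n) ∞ M] in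
theorem coordChange_apply (hp : p ∈ φ.source) : coordChange φ ψ (φ p) = ψ p := by
  simp [coordChange, hp]

theorem tangentCoord_coordChange (hφ : φ ∈ atlas (Euc n) M) (hψ : ψ ∈ atlas (Euc n) M)
    (hp : p ∈ φ.source) (hp' : p ∈ ψ.source) (v : TangentSpace (𝓡 n) p) :
    tangentCoord ψ p v = fderiv ℝ (coordChange φ ψ) (φ p) (tangentCoord φ p v) := by
  have h1 : MDifferentiableAt (𝓡 n) (𝓡 n) φ p := mdifferentiableAt_atlas hφ hp
  have h2 : MDifferentiableAt (𝓡 n) (𝓡 n) (coordChange φ ψ) (φ p) :=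
    ((contDiffAt_coordChange hφ hψ hp hp').differentiableAt (by simp)).mdifferentiableAt
  have h3 : (ψ : M → Euc n) =ᶠ[𝓝 p] coordChange φ ψ ∘ φ := by
    filter_upwards [φ.open_source.mem_nhds hp] with s hs
    exact (coordChange_apply hs).symm
  unfold tangentCoord
  rw [h3.mfderiv_eq, mfderiv_comp p h2 h1, ← mfderiv_eq_fderiv]
  rfl

theorem mfderiv_symm_eq_ofCoord (hφ : φ ∈ atlas (Euc n) M) {u : Euc n} (hu : u ∈ φ.target)
    (w : Euc n) : mfderiv (𝓡 n) (𝓡 n) φ.symm u w = ofCoord φ (φ.symm u) w := by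
  have h := (mdifferentiable_of_mem_atlas (I := 𝓡 n) hφ).comp_symm_deriv hu
  have h' := congrArg (fun L => L w) h
  have h2 : tangentCoord φ (φ.symm u) (mfderiv (𝓡 n) (𝓡 n) φ.symm u w) = w := h'
  have h3 := ofCoord_tangentCoord hφ (φ.map_target hu) (mfderiv (𝓡 n) (𝓡 n) φ.symm u w)
  rw [h2] at h3
  exact h3.symm

/-- Near `t` the curve is `φ.symm ∘ (φ ∘ x)`, so differentiability in the chart gives
differentiability into the manifold, and `velocity` is not the default value 0 of `mfderiv`. -/
theorem tangentCoord_velocity (hφ : φ ∈ atlas (Euc n) M) {x : ℝ → M} {t : ℝ}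
    (hx : ContinuousAt x t) (hd : DifferentiableAt ℝ (fun s => φ (x s)) t)
    (ht : x t ∈ φ.source) :
    tangentCoord φ (x t) (velocity x t) = deriv (fun s => φ (x s)) t := by
  have h1 : x =ᶠ[𝓝 t] φ.symm ∘ fun s => φ (x s) := by
    filter_upwards [hx.preimage_mem_nhds (φ.open_source.mem_nhds ht)] with s hs
    exact (φ.left_inv hs).symm
  have h2 : MDifferentiableAt 𝓘(ℝ, ℝ) (𝓡 n) x t := by
    refine MDifferentiableAt.congr_of_eventuallyEq ?_ h1
    exact (mdifferentiableAt_atlas_symm hφ (φ.map_source ht)).comp t hd.mdifferentiableAt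
  have h3 := mfderiv_comp t (mdifferentiableAt_atlas (I := 𝓡 n) hφ ht) h2
  have h4 : mfderiv 𝓘(ℝ, ℝ) (𝓡 n) (φ ∘ x) t = fderiv ℝ (fun s => φ (x s)) t :=
    mfderiv_eq_fderiv
  rw [h4] at h3
  rw [← fderiv_apply_one_eq_deriv, h3]
  rfl

omit [IsManifold (𝓡 n) ∞ M] in
theorem tangentCoord_smul (c : ℝ) (v : TangentSpace (𝓡 n) p) :
    tangentCoord φ p (c • v) = c • tangentCoord φ p v :=
  map_smul (mfderiv (𝓡 n) (𝓡 n) φ p) c v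

omit [IsManifold (𝓡 n) ∞ M] in
theorem tangentCoord_sum {ι : Type*} (s : Finset ι) (v : ι → TangentSpace (𝓡 n) p) :
    tangentCoord φ p (∑ i ∈ s, v i) = ∑ i ∈ s, tangentCoord φ p (v i) :=
  map_sum (mfderiv (𝓡 n) (𝓡 n) φ p) v s

theorem ofCoord_sum_smul (hφ : φ ∈ atlas (Euc n) M) (hp : p ∈ φ.source)
    (v : TangentSpace (𝓡 n) p) :
    v = ∑ i, tangentCoord φ p v i • ofCoord φ p (stdVec i) := by
  conv_lhs => rw [← ofCoord_tangentCoord hφ hp v, ← sum_coord_smul_stdVec (tangentCoord φ p v)]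
  simp only [ofCoord_eq_chartEquiv_symm hφ hp, map_sum, map_smul]

end Charts

section Metric

variable {n : ℕ} {M : Type*} [TopologicalSpace M] [ChartedSpace (Euc n) M]
  [IsManifold (𝓡 n) ∞ M] [RiemannianBundle (fun p : M => TangentSpace (𝓡 n) p)]
  {φ ψ : OpenPartialHomeomorph M (Euc n)} {p : M}

theorem inner_eq_sum_metricMatrix (hφ : φ ∈ atlas (Euc n) M) (hp : p ∈ φ.source)
    (v w : TangentSpace (𝓡 n) p) :
    inner ℝ v w = ∑ i, ∑ j, metricMatrix φ (φ p) i j *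
      (tangentCoord φ p v i * tangentCoord φ p w j) := by
  -- `metricMatrix` is evaluated in the tangent space at `φ.symm (φ p)`, which must be exchanged for
  -- the one at `p`.
  have h : ∀ q, q = p → ∀ a b : Euc n, inner ℝ (ofCoord φ q a) (ofCoord φ q b) =
      inner ℝ (ofCoord φ p a) (ofCoord φ p b) := by
    rintro q rfl a b
    rfl
  conv_lhs => rw [ofCoord_sum_smul hφ hp v, ofCoord_sum_smul hφ hp w]
  simp only [sum_inner, inner_sum, real_inner_smul_left, real_inner_smul_right, metricMatrix,
    Matrix.of_apply, h _ (φ.left_inv hp)]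
  rw [Finset.sum_comm]
  refine Finset.sum_congr rfl fun i _ => Finset.sum_congr rfl fun j _ => ?_
  ring

omit [IsManifold (𝓡 n) ∞ M] in
theorem metricMatrix_symm (u : Euc n) (i j : Fin n) :
    metricMatrix φ u i j = metricMatrix φ u j i := by
  simp only [metricMatrix, Matrix.of_apply]
  exact real_inner_comm _ _

/-- The matrix is the Gram matrix of a basis of the tangent space, hence positive definite. -/
theorem isUnit_det_metricMatrix (hφ : φ ∈ atlas (Euc n) M) {u : Euc n} (hu : u ∈ φ.target) :
    IsUnit (metricMatrix φ u).det := by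
  rw [← Matrix.isUnit_iff_isUnit_det]
  have h : metricMatrix φ u = Matrix.gram ℝ fun i => ofCoord φ (φ.symm u) (stdVec i) := rfl
  rw [h]
  refine (Matrix.posDef_gram_of_linearIndependent ?_).isUnit
  have hu' := φ.map_target hu
  simp only [ofCoord_eq_chartEquiv_symm hφ hu']
  have hl : LinearIndependent ℝ fun i : Fin n => (stdVec i : Euc n) := by
    convert! (EuclideanSpace.basisFun (Fin n) ℝ).toBasis.linearIndependent using 1
    ext i : 1
    simp
  exact hl.map' (chartEquiv hφ hu').symm.toLinearMap (chartEquiv hφ hu').symm.ker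

/-- The coordinate fields are images of constant fields under the tangent map of `φ.symm`, hence
smooth, and a smooth metric pairs smooth fields smoothly. -/
theorem contDiffOn_metricMatrix [IsContMDiffRiemannianBundle (𝓡 n) ∞ (EuclideanSpace ℝ (Fin n))
      (fun p : M => TangentSpace (𝓡 n) p)] (hφ : φ ∈ atlas (Euc n) M) (i j : Fin n) :
    ContDiffOn ℝ ∞ (fun u => metricMatrix φ u i j) φ.target := by
  rw [← contMDiffOn_iff_contDiffOn]
  have h1 : ∀ i : Fin n, ContMDiffOn (𝓡 n) ((𝓡 n).prod (𝓡 n)) ∞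
      (fun u => (⟨φ.symm u, ofCoord φ (φ.symm u) (stdVec i)⟩ :
        TotalSpace (Euc n) (fun p : M => TangentSpace (𝓡 n) p))) φ.target := by
    intro i
    have h2 := contMDiffOn_symm_of_mem_maximalAtlas (I := 𝓡 n) (n := ∞)
      (IsManifold.subset_maximalAtlas hφ)
    have h3 := h2.contMDiffOn_tangentMapWithin (m := ∞) (by simp)
      φ.open_target.uniqueMDiffOn
    have h4 : ContMDiff (𝓡 n) ((𝓡 n).prod (𝓡 n)) ∞
        (fun u => (⟨u, stdVec i⟩ : TangentBundle (𝓡 n) (Euc n))) := by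
      intro u
      exact contMDiffAt_vectorSpace_iff_contDiffAt.2 contDiffAt_const
    refine (h3.comp (s := φ.target) h4.contMDiffOn (fun u hu => hu)).congr fun u hu => ?_
    simp only [Function.comp, tangentMapWithin,
      mfderivWithin_of_isOpen φ.open_target hu, mfderiv_symm_eq_ofCoord hφ hu]
  exact (h1 i).inner_bundle (h1 j)

end Metric

end Rolling

/-! ### The Christoffel symbols as a bilinear map, and their transformation law -/

namespace Rolling

noncomputable section

theorem contDiffOn_sum_smul {F G ι : Type*} [NormedAddCommGroup F] [NormedSpace ℝ F]
    [NormedAddCommGroup G] [NormedSpace ℝ G] {s : Set F} {c : ι → F → ℝ} {L : ι → G} {k : ℕ∞ω}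
    (t : Finset ι) (h : ∀ i, ContDiffOn ℝ k (c i) s) :
    ContDiffOn ℝ k (fun u => ∑ i ∈ t, c i u • L i) s :=
  ContDiffOn.sum fun i _ => (h i).smul contDiffOn_const

theorem continuousOn_sum₃_smul {X G ι : Type*} [TopologicalSpace X] [Fintype ι]
    [NormedAddCommGroup G] [NormedSpace ℝ G] {s : Set X} {c : ι → ι → ι → X → ℝ}
    {L : ι → ι → ι → G} (h : ∀ k i j, ContinuousOn (c k i j) s) :
    ContinuousOn (fun u => ∑ k, ∑ i, ∑ j, c k i j u • L k i j) s :=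
  continuousOn_finsetSum _ fun k _ => continuousOn_finsetSum _ fun i _ =>
    continuousOn_finsetSum _ fun j _ => (h k i j).smul continuousOn_const

theorem eq_sum_stdVec_of_isLinearMap {n : ℕ} {f : Euc n → ℝ} (hf : IsLinearMap ℝ f) (v : Euc n) :
    f v = ∑ i, v i * f (stdVec i) := by
  have h := congrArg (hf.mk' f) (sum_coord_smul_stdVec v).symm
  simpa only [map_sum, map_smul, IsLinearMap.mk'_apply, smul_eq_mul] using h

theorem trilinear_expand {n : ℕ} (T : Euc n →L[ℝ] Euc n →L[ℝ] Euc n →L[ℝ] ℝ) (v w z : Euc n) :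
    T v w z = ∑ m, z m * ∑ i, ∑ j, v i * w j * T (stdVec i) (stdVec j) (stdVec m) := by
  have h1 : ∀ v w, IsLinearMap ℝ fun z => T v w z := fun v w => ⟨by simp, by simp⟩
  have h2 : ∀ v z, IsLinearMap ℝ fun w => T v w z := fun v z => ⟨by simp, by simp⟩
  have h3 : ∀ w z, IsLinearMap ℝ fun v => T v w z := fun v z => ⟨by simp, by simp⟩
  rw [eq_sum_stdVec_of_isLinearMap (h1 v w)]
  refine Finset.sum_congr rfl fun m _ => ?_
  congr 1
  rw [eq_sum_stdVec_of_isLinearMap (h3 w (stdVec m))]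
  refine Finset.sum_congr rfl fun i _ => ?_
  rw [eq_sum_stdVec_of_isLinearMap (h2 (stdVec i) (stdVec m)), Finset.mul_sum]
  simp only [mul_assoc]

theorem trilinear_expand' {n : ℕ} (T : Euc n →L[ℝ] Euc n →L[ℝ] Euc n →L[ℝ] ℝ) (z v w : Euc n) :
    T z v w = ∑ m, z m * ∑ i, ∑ j, v i * w j * T (stdVec m) (stdVec i) (stdVec j) := by
  rw [trilinear_expand]
  simp only [Finset.mul_sum]
  rw [Finset.sum_comm]
  refine Finset.sum_congr rfl fun m _ => ?_
  rw [Finset.sum_comm]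
  refine Finset.sum_congr rfl fun i _ => Finset.sum_congr rfl fun j _ => ?_
  ring

theorem bilinear_expand {n : ℕ} (T : Euc n →L[ℝ] Euc n →L[ℝ] ℝ) (v w : Euc n) :
    T v w = ∑ j, w j * ∑ i, v i * T (stdVec i) (stdVec j) := by
  rw [eq_sum_stdVec_of_isLinearMap (f := fun w => T v w) ⟨by simp, by simp⟩]
  refine Finset.sum_congr rfl fun m _ => ?_
  congr 1
  exact eq_sum_stdVec_of_isLinearMap (f := fun v => T v (stdVec m)) ⟨by simp, by simp⟩ v

theorem hasFDerivAt_bilin {F G : Type*} [NormedAddCommGroup F] [NormedSpace ℝ F]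
    [NormedAddCommGroup G] [NormedSpace ℝ G] {B : F → G →L[ℝ] G →L[ℝ] ℝ} {v w : F → G}
    {B' : F →L[ℝ] G →L[ℝ] G →L[ℝ] ℝ} {v' w' : F →L[ℝ] G} {u : F} (hB : HasFDerivAt B B' u)
    (hv : HasFDerivAt v v' u) (hw : HasFDerivAt w w' u) :
    ∃ L : F →L[ℝ] ℝ, HasFDerivAt (fun u => B u (v u) (w u)) L u ∧
      ∀ k, L k = B' k (v u) (w u) + B u (v' k) (w u) + B u (v u) (w' k) := by
  refine ⟨_, (hB.clm_apply hv).clm_apply hw, fun k => ?_⟩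
  simp
  ring

/-- Product rule for a pulled back form `h (Φ u) (J u v) (J u w)`. It will be used with `Φ` a
coordinate change, `J` its differential and `H` its second derivative. -/
theorem fderiv_pullback_bilin {F : Type*} [NormedAddCommGroup F] [NormedSpace ℝ F]
    {g h : F → F →L[ℝ] F →L[ℝ] ℝ} {g' h' : F →L[ℝ] F →L[ℝ] F →L[ℝ] ℝ} {Φ : F → F}
    {J : F → F →L[ℝ] F} {H : F →L[ℝ] F →L[ℝ] F} {u : F} (hg : HasFDerivAt g g' u)
    (hh : HasFDerivAt h h' (Φ u)) (hΦ : HasFDerivAt Φ (J u) u) (hJ : HasFDerivAt J H u)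
    {v w : F} (hev : (fun u => g u v w) =ᶠ[𝓝 u] fun u => h (Φ u) (J u v) (J u w)) (k : F) :
    g' k v w = h' (J u k) (J u v) (J u w) + h (Φ u) (H k v) (J u w) +
      h (Φ u) (J u v) (H k w) := by
  have hv : ∀ v : F, HasFDerivAt (fun u => J u v) (H.flip v) u := fun v => by
    have h1 := hJ.clm_apply (hasFDerivAt_const v u)
    rwa [ContinuousLinearMap.comp_zero, zero_add] at h1
  have hB : HasFDerivAt (fun u => h (Φ u)) (h'.comp (J u)) u :=
    HasFDerivAt.comp (g := h) (f := Φ) u hh hΦ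
  obtain ⟨R, hR, hR'⟩ := hasFDerivAt_bilin hB (hv v) (hv w)
  obtain ⟨L, hL, hL'⟩ := hasFDerivAt_bilin hg (hasFDerivAt_const v u) (hasFDerivAt_const w u)
  have h : R k = L k := by rw [(hR.congr_of_eventuallyEq hev).unique hL]
  rw [hR' k, hL' k] at h
  simpa using h.symm

variable {n : ℕ} {M : Type*} [TopologicalSpace M] [ChartedSpace (Euc n) M]
  [RiemannianBundle (fun p : M => TangentSpace (𝓡 n) p)]
  {φ ψ : OpenPartialHomeomorph M (Euc n)} {p : M} {u : Euc n}

/-- The metric in the chart `φ`, as a bilinear form on `ℝⁿ`. -/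
def metricForm (φ : OpenPartialHomeomorph M (Euc n)) (u : Euc n) : Euc n →L[ℝ] Euc n →L[ℝ] ℝ :=
  ∑ i, ∑ j, metricMatrix φ u i j •
    (EuclideanSpace.proj i : Euc n →L[ℝ] ℝ).smulRight (EuclideanSpace.proj j : Euc n →L[ℝ] ℝ)

/-- The Christoffel symbols in the chart `φ`, as a bilinear map on `ℝⁿ`. -/
def christoffelMap (φ : OpenPartialHomeomorph M (Euc n)) (u : Euc n) :
    Euc n →L[ℝ] Euc n →L[ℝ] Euc n :=
  ∑ k, ∑ i, ∑ j, christoffel φ u k i j • (EuclideanSpace.proj i : Euc n →L[ℝ] ℝ).smulRight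
    ((EuclideanSpace.proj j : Euc n →L[ℝ] ℝ).smulRight (stdVec k))

theorem metricForm_apply (v w : Euc n) :
    metricForm φ u v w = ∑ i, ∑ j, metricMatrix φ u i j * (v i * w j) := by
  simp [metricForm]

theorem metricForm_stdVec (i j : Fin n) :
    metricForm φ u (stdVec i) (stdVec j) = metricMatrix φ u i j := by
  rw [metricForm_apply, Finset.sum_eq_single i, Finset.sum_eq_single j] <;>
    simp +contextual [stdVec]

theorem metricForm_symm (v w : Euc n) : metricForm φ u v w = metricForm φ u w v := by
  rw [metricForm_apply, metricForm_apply, Finset.sum_comm]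
  refine Finset.sum_congr rfl fun i _ => Finset.sum_congr rfl fun j _ => ?_
  rw [metricMatrix_symm, mul_comm (v j)]

theorem christoffelMap_coord (v w : Euc n) (k : Fin n) :
    christoffelMap φ u v w k = ∑ i, ∑ j, christoffel φ u k i j * v i * w j := by
  simp only [christoffelMap, sum_apply, smul_apply, ContinuousLinearMap.smulRight_apply,
    PiLp.proj_apply, WithLp.ofLp_sum, Finset.sum_apply, PiLp.smul_apply, smul_eq_mul]
  rw [Finset.sum_eq_single k]
  · simp [mul_assoc]
  · intro l _ hl
    simp [hl.symm]
  · simp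

theorem covDerivIn_eq (x : ℝ → M) (Z : ∀ t : ℝ, TangentSpace (𝓡 n) (x t)) (t : ℝ) :
    covDerivIn φ x Z t = ofCoord φ (x t) (deriv (fun s => tangentCoord φ (x s) (Z s)) t +
      christoffelMap φ (φ (x t)) (deriv (fun s => φ (x s)) t) (tangentCoord φ (x t) (Z t))) := by
  unfold covDerivIn
  congr 1
  ext k
  simp only [PiLp.add_apply, christoffelMap_coord]

variable [IsManifold (𝓡 n) ∞ M]

theorem inner_eq_metricForm (hφ : φ ∈ atlas (Euc n) M) (hp : p ∈ φ.source)
    (v w : TangentSpace (𝓡 n) p) :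
    inner ℝ v w = metricForm φ (φ p) (tangentCoord φ p v) (tangentCoord φ p w) := by
  rw [inner_eq_sum_metricMatrix hφ hp, metricForm_apply]

theorem metricForm_nondegenerate (hφ : φ ∈ atlas (Euc n) M) (hp : p ∈ φ.source) {v : Euc n}
    (h : ∀ z, metricForm φ (φ p) v z = 0) : v = 0 := by
  have h1 : inner ℝ (ofCoord φ p v) (ofCoord φ p v) = (0 : ℝ) := by
    rw [inner_eq_metricForm hφ hp, tangentCoord_ofCoord hφ hp, h]
  rw [inner_self_eq_zero] at h1
  rw [← tangentCoord_ofCoord hφ hp v, h1]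
  exact map_zero (mfderiv (𝓡 n) (𝓡 n) φ p)

variable [IsContMDiffRiemannianBundle (𝓡 n) ∞ (EuclideanSpace ℝ (Fin n))
      (fun p : M => TangentSpace (𝓡 n) p)]

theorem contDiffOn_metricForm (hφ : φ ∈ atlas (Euc n) M) :
    ContDiffOn ℝ ∞ (metricForm φ) φ.target := by
  unfold metricForm
  exact ContDiffOn.sum fun i _ => contDiffOn_sum_smul _ fun j => contDiffOn_metricMatrix hφ i j

theorem differentiableAt_metricForm (hφ : φ ∈ atlas (Euc n) M) (hu : u ∈ φ.target) :
    DifferentiableAt ℝ (metricForm φ) u :=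
  ((contDiffOn_metricForm hφ).contDiffAt (φ.open_target.mem_nhds hu)).differentiableAt (by simp)

theorem metricPartial_eq (hφ : φ ∈ atlas (Euc n) M) (hu : u ∈ φ.target) (k i j : Fin n) :
    metricPartial φ u k i j = fderiv ℝ (metricForm φ) u (stdVec k) (stdVec i) (stdVec j) := by
  unfold metricPartial
  simp only [← metricForm_stdVec]
  obtain ⟨L, hL, h⟩ := hasFDerivAt_bilin (differentiableAt_metricForm hφ hu).hasFDerivAt
    (hasFDerivAt_const (stdVec i) u) (hasFDerivAt_const (stdVec j) u)
  rw [hL.fderiv, h]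
  simp

/-- The Koszul formula for coordinate vector fields. -/
theorem metricForm_christoffelMap (hφ : φ ∈ atlas (Euc n) M) (hu : u ∈ φ.target) (v w z : Euc n) :
    metricForm φ u (christoffelMap φ u v w) z = 1 / 2 * (fderiv ℝ (metricForm φ) u v w z +
      fderiv ℝ (metricForm φ) u w v z - fderiv ℝ (metricForm φ) u z v w) := by
  -- Lowering the upper index with the metric cancels the inverse matrix in the Christoffel symbol.
  have key : ∀ m i j, ∑ k, metricMatrix φ u k m * christoffel φ u k i j =
      1 / 2 * (metricPartial φ u i j m + metricPartial φ u j i m - metricPartial φ u m i j) := by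
    intro m i j
    set c : Fin n → ℝ := fun l => metricPartial φ u i j l + metricPartial φ u j i l -
      metricPartial φ u l i j
    have h1 : (metricMatrix φ u).mulVec ((metricMatrix φ u)⁻¹.mulVec c) = c := by
      rw [Matrix.mulVec_mulVec, Matrix.mul_nonsing_inv _ (isUnit_det_metricMatrix hφ hu),
        Matrix.one_mulVec]
    have h2 := congrFun h1 m
    simp only [Matrix.mulVec, dotProduct] at h2
    simp only [christoffel]
    change _ = 1 / 2 * c m
    rw [← h2, Finset.mul_sum]
    refine Finset.sum_congr rfl fun k _ => ?_
    rw [metricMatrix_symm u k m]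
    ring
  have hD := trilinear_expand (fderiv ℝ (metricForm φ) u)
  have hL : metricForm φ u (christoffelMap φ u v w) z = ∑ m, z m * ∑ i, ∑ j, v i * w j *
      ∑ k, metricMatrix φ u k m * christoffel φ u k i j := by
    rw [bilinear_expand]
    refine Finset.sum_congr rfl fun m _ => ?_
    congr 1
    simp only [christoffelMap_coord, metricForm_stdVec, Finset.mul_sum, Finset.sum_mul]
    rw [Finset.sum_comm]
    refine Finset.sum_congr rfl fun i _ => ?_
    rw [Finset.sum_comm]
    refine Finset.sum_congr rfl fun j _ => Finset.sum_congr rfl fun k _ => ?_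
    ring
  have e2 : fderiv ℝ (metricForm φ) u w v z =
      ∑ m, z m * ∑ i, ∑ j, v i * w j * metricPartial φ u j i m := by
    rw [hD]
    refine Finset.sum_congr rfl fun m _ => ?_
    rw [Finset.sum_comm]
    congr 1
    refine Finset.sum_congr rfl fun i _ => Finset.sum_congr rfl fun j _ => ?_
    rw [metricPartial_eq hφ hu]
    ring
  have e3 : fderiv ℝ (metricForm φ) u z v w =
      ∑ m, z m * ∑ i, ∑ j, v i * w j * metricPartial φ u m i j := by
    rw [trilinear_expand']
    simp only [metricPartial_eq hφ hu]
  rw [hL, e2, e3, hD]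
  simp only [key, ← metricPartial_eq hφ hu, Finset.mul_sum, ← Finset.sum_add_distrib,
    ← Finset.sum_sub_distrib]
  refine Finset.sum_congr rfl fun m _ => Finset.sum_congr rfl fun i _ =>
    Finset.sum_congr rfl fun j _ => ?_
  ring

/-- Continuity is what makes the coefficient of the parallel transport equation integrable. The
inverse metric is handled as adjugate divided by determinant. -/
theorem continuousOn_christoffelMap (hφ : φ ∈ atlas (Euc n) M) :
    ContinuousOn (christoffelMap φ) φ.target := by
  have h1 : ∀ i j k, ContinuousOn (fun u => metricPartial φ u k i j) φ.target := by
    intro i j k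
    have := (contDiffOn_metricMatrix hφ i j).continuousOn_fderiv_of_isOpen φ.open_target (by simp)
    exact this.clm_apply continuousOn_const
  have h2 : ContinuousOn (metricMatrix φ) φ.target :=
    continuousOn_pi.2 fun i => continuousOn_pi.2 fun j => (contDiffOn_metricMatrix hφ i j).continuousOn
  have h3 : ∀ k l, ContinuousOn (fun u => (metricMatrix φ u)⁻¹ k l) φ.target := by
    intro k l
    have hd : ContinuousOn (fun u => (metricMatrix φ u).det) φ.target :=
      (continuous_id.matrix_det (A := fun A : Matrix (Fin n) (Fin n) ℝ => A)).comp_continuousOn h2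
    have ha : ContinuousOn (fun u => (metricMatrix φ u).adjugate k l) φ.target :=
      ((continuous_id.matrix_adjugate
        (A := fun A : Matrix (Fin n) (Fin n) ℝ => A)).matrix_elem k l).comp_continuousOn h2
    have := (hd.inv₀ fun u hu => (isUnit_det_metricMatrix hφ hu).ne_zero).mul ha
    refine this.congr fun u hu => ?_
    simp [Matrix.inv_def]
  have h4 : ∀ k i j, ContinuousOn (fun u => christoffel φ u k i j) φ.target := by
    intro k i j
    unfold christoffel
    exact continuousOn_const.mul (continuousOn_finsetSum _ fun l _ =>
      (h3 k l).mul (((h1 _ _ _).add (h1 _ _ _)).sub (h1 _ _ _)))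
  exact continuousOn_sum₃_smul (L := fun k i j =>
    (EuclideanSpace.proj i : Euc n →L[ℝ] ℝ).smulRight
      ((EuclideanSpace.proj j : Euc n →L[ℝ] ℝ).smulRight (stdVec k))) h4

omit [IsContMDiffRiemannianBundle (𝓡 n) ∞ (EuclideanSpace ℝ (Fin n))
      (fun p : M => TangentSpace (𝓡 n) p)] in
theorem metricForm_coordChange (hφ : φ ∈ atlas (Euc n) M) (hψ : ψ ∈ atlas (Euc n) M)
    (hp : p ∈ φ.source) (hp' : p ∈ ψ.source) (v w : Euc n) :
    metricForm φ (φ p) v w = metricForm ψ (coordChange φ ψ (φ p))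
      (fderiv ℝ (coordChange φ ψ) (φ p) v) (fderiv ℝ (coordChange φ ψ) (φ p) w) := by
  have h := inner_eq_metricForm hφ hp (ofCoord φ p v) (ofCoord φ p w)
  rw [inner_eq_metricForm hψ hp', tangentCoord_coordChange hφ hψ hp hp',
    tangentCoord_coordChange hφ hψ hp hp'] at h
  simp only [tangentCoord_ofCoord hφ hp] at h
  rw [coordChange_apply hp, h]

theorem fderiv_metricForm_coordChange (hφ : φ ∈ atlas (Euc n) M) (hψ : ψ ∈ atlas (Euc n) M)
    (hp : p ∈ φ.source) (hp' : p ∈ ψ.source) (k v w : Euc n) :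
    fderiv ℝ (metricForm φ) (φ p) k v w =
      fderiv ℝ (metricForm ψ) (ψ p) (fderiv ℝ (coordChange φ ψ) (φ p) k)
        (fderiv ℝ (coordChange φ ψ) (φ p) v) (fderiv ℝ (coordChange φ ψ) (φ p) w) +
      metricForm ψ (ψ p) (fderiv ℝ (fderiv ℝ (coordChange φ ψ)) (φ p) k v)
        (fderiv ℝ (coordChange φ ψ) (φ p) w) +
      metricForm ψ (ψ p) (fderiv ℝ (coordChange φ ψ) (φ p) v)
        (fderiv ℝ (fderiv ℝ (coordChange φ ψ)) (φ p) k w) := by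
  have hF := contDiffAt_coordChange hφ hψ hp hp'
  have hFd := (hF.differentiableAt (by simp)).hasFDerivAt
  have hF2 := ((hF.fderiv_right (m := ∞) (by simp)).differentiableAt (by simp)).hasFDerivAt
  have hψd : HasFDerivAt (metricForm ψ) (fderiv ℝ (metricForm ψ) (ψ p))
      (coordChange φ ψ (φ p)) := by
    rw [coordChange_apply hp]
    exact (differentiableAt_metricForm hψ (ψ.map_source hp')).hasFDerivAt
  have hev : (fun u => metricForm φ u v w) =ᶠ[𝓝 (φ p)] fun u => metricForm ψ (coordChange φ ψ u)
      (fderiv ℝ (coordChange φ ψ) u v) (fderiv ℝ (coordChange φ ψ) u w) := by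
    filter_upwards [(φ.symm.trans ψ).open_source.mem_nhds
      (show φ p ∈ (φ.symm.trans ψ).source from ⟨φ.map_source hp, by simpa [hp] using hp'⟩)]
      with u hu
    have h := metricForm_coordChange hφ hψ (φ.map_target hu.1) hu.2 v w
    rwa [φ.right_inv hu.1] at h
  have h := fderiv_pullback_bilin
    (differentiableAt_metricForm hφ (φ.map_source hp)).hasFDerivAt hψd hFd hF2 hev k
  rwa [coordChange_apply hp] at h

/-- By nondegeneracy it suffices to pair with vectors `J z`, and the Koszul formula then applies in
both charts. Differentiating the pulled back metric yields six second-derivative terms; by symmetry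
of `H` four cancel, and the other two combine to `H v w` paired with `J z`. -/
theorem christoffelMap_coordChange (hφ : φ ∈ atlas (Euc n) M) (hψ : ψ ∈ atlas (Euc n) M)
    (hp : p ∈ φ.source) (hp' : p ∈ ψ.source) (v w : Euc n) :
    fderiv ℝ (coordChange φ ψ) (φ p) (christoffelMap φ (φ p) v w) =
      fderiv ℝ (fderiv ℝ (coordChange φ ψ)) (φ p) v w +
      christoffelMap ψ (ψ p) (fderiv ℝ (coordChange φ ψ) (φ p) v)
        (fderiv ℝ (coordChange φ ψ) (φ p) w) := by
  set J := fderiv ℝ (coordChange φ ψ) (φ p) with hJ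
  set H := fderiv ℝ (fderiv ℝ (coordChange φ ψ)) (φ p) with hH
  have hsymm : ∀ a b, H a b = H b a := fun a b =>
    (contDiffAt_coordChange hφ hψ hp hp').isSymmSndFDerivAt
      (by rw [minSmoothness_of_isRCLikeNormedField]; exact ENat.LEInfty.out) a b
  have hsurj : Function.Surjective J := fun b => by
    refine ⟨tangentCoord φ p (ofCoord ψ p b), ?_⟩
    rw [hJ, ← tangentCoord_coordChange hφ hψ hp hp', tangentCoord_ofCoord hψ hp']
  rw [← sub_eq_zero]
  refine metricForm_nondegenerate hψ hp' fun z => ?_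
  obtain ⟨z, rfl⟩ := hsurj z
  have h1 := metricForm_coordChange hφ hψ hp hp' (christoffelMap φ (φ p) v w) z
  rw [metricForm_christoffelMap hφ (φ.map_source hp), coordChange_apply hp, ← hJ] at h1
  rw [map_sub, map_add, sub_apply, add_apply, ← h1,
    metricForm_christoffelMap hψ (ψ.map_source hp'),
    fderiv_metricForm_coordChange hφ hψ hp hp', fderiv_metricForm_coordChange hφ hψ hp hp',
    fderiv_metricForm_coordChange hφ hψ hp hp', ← hJ, ← hH, hsymm w v, hsymm z v, hsymm z w,
    metricForm_symm (J v) (H w z), metricForm_symm (J w) (H v z)]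
  ring

end

end Rolling

/-! ### Vector fields along curves -/

namespace Rolling

noncomputable section

theorem hasDerivAt_bilin {F G : Type*} [NormedAddCommGroup F] [NormedSpace ℝ F]
    [NormedAddCommGroup G] [NormedSpace ℝ G] {B : F → G →L[ℝ] G →L[ℝ] ℝ}
    {B' : F →L[ℝ] G →L[ℝ] G →L[ℝ] ℝ} {v w : ℝ → G} {u : ℝ → F} {v' w' : G} {u' : F} {t : ℝ}
    (hB : HasFDerivAt B B' (u t)) (hu : HasDerivAt u u' t) (hv : HasDerivAt v v' t)
    (hw : HasDerivAt w w' t) : HasDerivAt (fun s => B (u s) (v s) (w s))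
      (B' u' (v t) (w t) + B (u t) v' (w t) + B (u t) (v t) w') t := by
  have h1 : HasDerivAt (fun s => B (u s)) (B' u') t :=
    HasFDerivAt.comp_hasDerivAt (l := B) (f := u) t hB hu
  have h2 := (h1.clm_apply hv).clm_apply hw
  rwa [add_apply] at h2

variable {n : ℕ} {M : Type*} [TopologicalSpace M] [ChartedSpace (Euc n) M]
  {x : ℝ → M} {Z W : ∀ t : ℝ, TangentSpace (𝓡 n) (x t)} {a b c d t : ℝ}
  {φ ψ : OpenPartialHomeomorph M (Euc n)}

variable (n) in
/-- `x` is absolutely continuous on `[a, b]`. -/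
def CurveOn (a b : ℝ) (x : ℝ → M) : Prop :=
  ContinuousOn x (Icc a b) ∧
    ∀ φ ∈ atlas (Euc n) M, ∀ c d : ℝ, c ≤ d → Icc c d ⊆ Icc a b →
      (∀ t ∈ Icc c d, x t ∈ φ.source) → AbsolutelyContinuousOnInterval (fun t => φ (x t)) c d

/-- The vector field `Z` along `x` is absolutely continuous on `[a, b]`. -/
def FieldOn (a b : ℝ) (x : ℝ → M) (Z : ∀ t : ℝ, TangentSpace (𝓡 n) (x t)) : Prop :=
  ∀ φ ∈ atlas (Euc n) M, ∀ c d : ℝ, c ≤ d → Icc c d ⊆ Icc a b →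
    (∀ t ∈ Icc c d, x t ∈ φ.source) →
      AbsolutelyContinuousOnInterval (fun t => tangentCoord φ (x t) (Z t)) c d

variable (n) in
/-- `x` is continuous at `t`, and differentiable in charts. -/
def CurveDiffAt (x : ℝ → M) (t : ℝ) : Prop :=
  ContinuousAt x t ∧ ∀ φ ∈ atlas (Euc n) M, x t ∈ φ.source →
    DifferentiableAt ℝ (fun s => φ (x s)) t

/-- The components of `Z` in charts are differentiable at `t`. -/
def FieldDiffAt (x : ℝ → M) (Z : ∀ t : ℝ, TangentSpace (𝓡 n) (x t)) (t : ℝ) : Prop :=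
  ∀ φ ∈ atlas (Euc n) M, x t ∈ φ.source →
    DifferentiableAt ℝ (fun s => tangentCoord φ (x s) (Z s)) t

theorem CurveOn.mono (h : CurveOn n a b x) (hcd : Icc c d ⊆ Icc a b) : CurveOn n c d x :=
  ⟨h.1.mono hcd, fun φ hφ e f hef h1 h2 => h.2 φ hφ e f hef (h1.trans hcd) h2⟩

theorem CurveOn.exists_nhds_chart (h : CurveOn n a b x) (ht : t ∈ Icc a b) :
    ∃ U ∈ 𝓝 t, ∀ s ∈ Icc a b, s ∈ U → x s ∈ (chartAt (Euc n) (x t)).source := by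
  have h1 := (h.1 t ht) ((chartAt (Euc n) (x t)).open_source.mem_nhds (mem_chart_source _ (x t)))
  obtain ⟨U, hU, hU'⟩ := mem_nhdsWithin_iff_exists_mem_nhds_inter.1 h1
  exact ⟨U, hU, fun s hs hsU => hU' ⟨hsU, hs⟩⟩

theorem ae_of_local {Q : ℝ → Prop} (hab : a ≤ b)
    (h : ∀ t ∈ Icc a b, ∃ U ∈ 𝓝 t, ∀ c d, c ≤ d → Icc c d ⊆ Icc a b → Icc c d ⊆ U →
      ∀ᵐ s : ℝ, s ∈ Icc c d → Q s) : ∀ᵐ s : ℝ, s ∈ Icc a b → Q s := by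
  refine interval_induction hab (fun c d => ∀ᵐ s : ℝ, s ∈ Icc c d → Q s) ?_ h
  intro c d e _ _ _ _ h1 h2
  filter_upwards [h1, h2] with s hs hs' hse
  rcases le_total s d with h | h
  · exact hs ⟨hse.1, h⟩
  · exact hs' ⟨h, hse.2⟩

/-- Curves have arbitrary values outside the interval while `deriv` is two-sided; discarding the
null set of endpoints makes the derivatives depend only on the interval. -/
theorem ae_mem_Ioo (a b : ℝ) : ∀ᵐ t : ℝ, t ∈ Icc a b → t ∈ Ioo a b := by
  filter_upwards [Measure.ae_ne volume a, Measure.ae_ne volume b] with t h1 h2 ht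
  exact ⟨lt_of_le_of_ne ht.1 (Ne.symm h1), lt_of_le_of_ne ht.2 h2⟩

variable [IsManifold (𝓡 n) ∞ M]

theorem contDiffOn_fderiv_coordChange (hφ : φ ∈ atlas (Euc n) M) (hψ : ψ ∈ atlas (Euc n) M) :
    ContDiffOn ℝ 1 (fun q : Euc n × Euc n => fderiv ℝ (coordChange φ ψ) q.1 q.2)
      ((φ.symm.trans ψ).source ×ˢ univ) := by
  have h1 : ContDiffOn ℝ 1 (fderiv ℝ (coordChange φ ψ)) (φ.symm.trans ψ).source :=
    ((contDiffOn_coordChange hφ hψ).fderiv_of_isOpen (φ.symm.trans ψ).open_source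
      (m := ∞) (by simp)).of_le ENat.LEInfty.out
  exact (h1.comp contDiffOn_fst fun q hq => hq.1).clm_apply contDiffOn_snd

omit [ChartedSpace (Euc n) M] [IsManifold (𝓡 n) ∞ M] in
theorem mem_symm_trans_source {p : M} (hp : p ∈ φ.source) (hp' : p ∈ ψ.source) :
    φ p ∈ (φ.symm.trans ψ).source :=
  ⟨φ.map_source hp, by simpa [hp] using hp'⟩

/-- The new components are a C¹ function of the pair (position, old components), namely the
differential of the coordinate change. -/
theorem ac_tangentCoord_of_chart (hφ : φ ∈ atlas (Euc n) M) (hψ : ψ ∈ atlas (Euc n) M)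
    (hcd : c ≤ d) (hs : ∀ t ∈ Icc c d, x t ∈ φ.source) (hs' : ∀ t ∈ Icc c d, x t ∈ ψ.source)
    (hx : AbsolutelyContinuousOnInterval (fun t => φ (x t)) c d)
    (hZ : AbsolutelyContinuousOnInterval (fun t => tangentCoord φ (x t) (Z t)) c d) :
    AbsolutelyContinuousOnInterval (fun t => tangentCoord ψ (x t) (Z t)) c d := by
  have h := (hx.prodMk hZ).comp_contDiffOn hcd
    ((φ.symm.trans ψ).open_source.prod isOpen_univ) (contDiffOn_fderiv_coordChange hφ hψ)
    fun t ht => ⟨mem_symm_trans_source (hs t ht) (hs' t ht), mem_univ _⟩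
  refine h.congr fun t ht => ?_
  rw [uIcc_of_le hcd] at ht
  exact (tangentCoord_coordChange hφ hψ (hs t ht) (hs' t ht) _).symm

/-- Absolute continuity of a field may be checked locally, in the preferred charts. -/
theorem FieldOn.of_local (hx : CurveOn n a b x)
    (h : ∀ t ∈ Icc a b, ∃ U ∈ 𝓝 t, ∀ c d, c ≤ d → Icc c d ⊆ Icc a b → Icc c d ⊆ U →
      (∀ s ∈ Icc c d, x s ∈ (chartAt (Euc n) (x t)).source) → AbsolutelyContinuousOnInterval
        (fun s => tangentCoord (chartAt (Euc n) (x t)) (x s) (Z s)) c d) : FieldOn a b x Z := by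
  intro ψ hψ e f hef hef' hs'
  refine AbsolutelyContinuousOnInterval.of_local hef fun t ht => ?_
  obtain ⟨U, hU, hUx⟩ := hx.exists_nhds_chart (hef' ht)
  obtain ⟨V, hV, hVx⟩ := h t (hef' ht)
  refine ⟨U ∩ V, Filter.inter_mem hU hV, fun c d hcd h1 h2 => ?_⟩
  have hs : ∀ s ∈ Icc c d, x s ∈ (chartAt (Euc n) (x t)).source := fun s hs =>
    hUx s (hef' (h1 hs)) (h2 hs).1
  exact ac_tangentCoord_of_chart (chart_mem_atlas _ _) hψ hcd hs (fun s hs => hs' s (h1 hs))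
    (hx.2 _ (chart_mem_atlas _ _) c d hcd (h1.trans hef') hs)
    (hVx c d hcd (h1.trans hef') (fun s hs => (h2 hs).2) hs)

theorem CurveDiffAt.of_chart (hφ : φ ∈ atlas (Euc n) M) (hc : ContinuousAt x t)
    (hs : x t ∈ φ.source) (hd : DifferentiableAt ℝ (fun s => φ (x s)) t) : CurveDiffAt n x t := by
  refine ⟨hc, fun ψ hψ hs' => ?_⟩
  have h1 := ((contDiffAt_coordChange hφ hψ hs hs').differentiableAt (by simp)).comp t hd
  refine h1.congr_of_eventuallyEq ?_
  filter_upwards [hc.preimage_mem_nhds (φ.open_source.mem_nhds hs)] with s hs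
  exact (coordChange_apply hs).symm

theorem hasDerivAt_tangentCoord_coordChange (hφ : φ ∈ atlas (Euc n) M)
    (hψ : ψ ∈ atlas (Euc n) M) (hc : ContinuousAt x t) (hs : x t ∈ φ.source)
    (hs' : x t ∈ ψ.source) (hd : DifferentiableAt ℝ (fun s => φ (x s)) t)
    (hZ : DifferentiableAt ℝ (fun s => tangentCoord φ (x s) (Z s)) t) :
    HasDerivAt (fun s => tangentCoord ψ (x s) (Z s))
      (fderiv ℝ (fderiv ℝ (coordChange φ ψ)) (φ (x t)) (deriv (fun s => φ (x s)) t)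
        (tangentCoord φ (x t) (Z t)) + fderiv ℝ (coordChange φ ψ) (φ (x t))
          (deriv (fun s => tangentCoord φ (x s) (Z s)) t)) t := by
  have h1 : HasFDerivAt (fderiv ℝ (coordChange φ ψ))
      (fderiv ℝ (fderiv ℝ (coordChange φ ψ)) (φ (x t))) (φ (x t)) :=
    (((contDiffAt_coordChange hφ hψ hs hs').fderiv_right (m := ∞) (by simp)).differentiableAt
      (by simp)).hasFDerivAt
  have h2 : HasDerivAt (fun s => fderiv ℝ (coordChange φ ψ) (φ (x s))) _ t :=
    HasFDerivAt.comp_hasDerivAt (l := fderiv ℝ (coordChange φ ψ)) (f := fun s => φ (x s))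
      t h1 hd.hasDerivAt
  refine (h2.clm_apply hZ.hasDerivAt).congr_of_eventuallyEq ?_
  filter_upwards [hc.preimage_mem_nhds (φ.open_source.mem_nhds hs),
    hc.preimage_mem_nhds (ψ.open_source.mem_nhds hs')] with s hs hs'
  exact tangentCoord_coordChange hφ hψ hs hs' _

theorem FieldDiffAt.of_chart (hφ : φ ∈ atlas (Euc n) M) (hc : ContinuousAt x t)
    (hs : x t ∈ φ.source) (hd : DifferentiableAt ℝ (fun s => φ (x s)) t)
    (hZ : DifferentiableAt ℝ (fun s => tangentCoord φ (x s) (Z s)) t) : FieldDiffAt x Z t :=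
  fun _ hψ hs' =>
    (hasDerivAt_tangentCoord_coordChange hφ hψ hc hs hs' hd hZ).differentiableAt

theorem CurveOn.ae_curveDiffAt (hx : CurveOn n a b x) (hab : a ≤ b) :
    ∀ᵐ t : ℝ, t ∈ Icc a b → t ∈ Ioo a b ∧ CurveDiffAt n x t := by
  refine ae_of_local hab fun t ht => ?_
  obtain ⟨U, hU, hUx⟩ := hx.exists_nhds_chart ht
  refine ⟨U, hU, fun c d hcd h1 h2 => ?_⟩
  have hs : ∀ s ∈ Icc c d, x s ∈ (chartAt (Euc n) (x t)).source := fun s hs =>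
    hUx s (h1 hs) (h2 hs)
  have hac := hx.2 _ (chart_mem_atlas _ _) c d hcd h1 hs
  filter_upwards [hac.ae_differentiableAt_euclidean, ae_mem_Ioo a b] with s h3 h4 hscd
  have h5 := h4 (h1 hscd)
  rw [uIcc_of_le hcd] at h3
  exact ⟨h5, .of_chart (chart_mem_atlas _ _) (hx.1.continuousAt (Icc_mem_nhds h5.1 h5.2))
    (hs s hscd) (h3 hscd)⟩

theorem FieldOn.ae_fieldDiffAt (hZ : FieldOn a b x Z) (hx : CurveOn n a b x) (hab : a ≤ b) :
    ∀ᵐ t : ℝ, t ∈ Icc a b → FieldDiffAt x Z t := by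
  refine ae_of_local hab fun t ht => ?_
  obtain ⟨U, hU, hUx⟩ := hx.exists_nhds_chart ht
  refine ⟨U, hU, fun c d hcd h1 h2 => ?_⟩
  have hs : ∀ s ∈ Icc c d, x s ∈ (chartAt (Euc n) (x t)).source := fun s hs =>
    hUx s (h1 hs) (h2 hs)
  have hac := hZ _ (chart_mem_atlas _ _) c d hcd h1 hs
  filter_upwards [hac.ae_differentiableAt_euclidean, hx.ae_curveDiffAt hab] with s h3 h4 hscd
  obtain ⟨-, h5⟩ := h4 (h1 hscd)
  rw [uIcc_of_le hcd] at h3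
  exact .of_chart (chart_mem_atlas _ _) h5.1 (hs s hscd)
    (h5.2 _ (chart_mem_atlas _ _) (hs s hscd)) (h3 hscd)

variable [RiemannianBundle (fun p : M => TangentSpace (𝓡 n) p)]
  [IsContMDiffRiemannianBundle (𝓡 n) ∞ (EuclideanSpace ℝ (Fin n))
      (fun p : M => TangentSpace (𝓡 n) p)]

omit [IsManifold (𝓡 n) ∞ M] [IsContMDiffRiemannianBundle (𝓡 n) ∞ (EuclideanSpace ℝ (Fin n))
      (fun p : M => TangentSpace (𝓡 n) p)] in
/-- The covariant derivative depends only on the germ of the field. -/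
theorem covDeriv_congr (h : ∀ᶠ s in 𝓝 t, Z s = W s) : covDeriv x Z t = covDeriv x W t := by
  unfold covDeriv
  rw [covDerivIn_eq, covDerivIn_eq, h.self_of_nhds]
  congr 2
  refine Filter.EventuallyEq.deriv_eq ?_
  filter_upwards [h] with s hs
  rw [hs]

/-- The covariant derivative may be computed in any chart. -/
theorem covDerivIn_eq_of_charts (hφ : φ ∈ atlas (Euc n) M) (hψ : ψ ∈ atlas (Euc n) M)
    (hx : CurveDiffAt n x t) (hZ : FieldDiffAt x Z t) (hs : x t ∈ φ.source)
    (hs' : x t ∈ ψ.source) : covDerivIn φ x Z t = covDerivIn ψ x Z t := by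
  have hd := hx.2 φ hφ hs
  have hZd := hZ φ hφ hs
  -- The second derivative of the coordinate change occurs in the law for the Christoffel symbols
  -- and in the derivative of the components, and it cancels.
  rw [← ofCoord_tangentCoord hψ hs' (covDerivIn φ x Z t), tangentCoord_coordChange hφ hψ hs hs',
    covDerivIn_eq, covDerivIn_eq, tangentCoord_ofCoord hφ hs, map_add,
    christoffelMap_coordChange hφ hψ hs hs',
    (hasDerivAt_tangentCoord_coordChange hφ hψ hx.1 hs hs' hd hZd).deriv,
    tangentCoord_coordChange hφ hψ hs hs' (Z t)]
  have h1 : deriv (fun s => ψ (x s)) t =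
      fderiv ℝ (coordChange φ ψ) (φ (x t)) (deriv (fun s => φ (x s)) t) := by
    have h2 := ((contDiffAt_coordChange hφ hψ hs hs').differentiableAt
      (by simp)).hasFDerivAt.comp_hasDerivAt t hd.hasDerivAt
    refine (h2.congr_of_eventuallyEq ?_).deriv
    filter_upwards [hx.1.preimage_mem_nhds (φ.open_source.mem_nhds hs)] with s hs
    exact (coordChange_apply hs).symm
  rw [h1]
  congr 1
  abel

theorem covDeriv_eq_covDerivIn (hφ : φ ∈ atlas (Euc n) M) (hx : CurveDiffAt n x t)
    (hZ : FieldDiffAt x Z t) (hs : x t ∈ φ.source) : covDeriv x Z t = covDerivIn φ x Z t :=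
  covDerivIn_eq_of_charts (chart_mem_atlas _ _) hφ hx hZ (mem_chart_source _ _) hs

/-- The covariant derivative is compatible with the metric. -/
theorem hasDerivAt_inner (hx : CurveDiffAt n x t) (hZ : FieldDiffAt x Z t)
    (hW : FieldDiffAt x W t) : HasDerivAt (fun s => inner ℝ (Z s) (W s))
      (inner ℝ (covDeriv x Z t) (W t) + inner ℝ (Z t) (covDeriv x W t)) t := by
  set φ := chartAt (Euc n) (x t) with hφ'
  have hφ : φ ∈ atlas (Euc n) M := chart_mem_atlas _ _
  have hs : x t ∈ φ.source := mem_chart_source _ _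
  have hu := φ.map_source hs
  have h := hasDerivAt_bilin (u := fun s => φ (x s))
    (differentiableAt_metricForm hφ hu).hasFDerivAt (hx.2 φ hφ hs).hasDerivAt
    (hZ φ hφ hs).hasDerivAt (hW φ hφ hs).hasDerivAt
  have hev : (fun s => inner ℝ (Z s) (W s)) =ᶠ[𝓝 t] fun s => metricForm φ (φ (x s))
      (tangentCoord φ (x s) (Z s)) (tangentCoord φ (x s) (W s)) := by
    filter_upwards [hx.1.preimage_mem_nhds (φ.open_source.mem_nhds hs)] with s hs
    exact inner_eq_metricForm hφ hs _ _
  convert! h.congr_of_eventuallyEq hev using 1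
  -- In the sum of the two Koszul formulas the last two terms of each cancel, leaving the derivative
  -- of the metric along the velocity.
  rw [covDeriv, covDeriv, ← hφ', covDerivIn_eq, covDerivIn_eq, inner_eq_metricForm hφ hs,
    inner_eq_metricForm hφ hs, tangentCoord_ofCoord hφ hs, tangentCoord_ofCoord hφ hs, map_add,
    map_add, add_apply, metricForm_christoffelMap hφ hu,
    metricForm_symm (tangentCoord φ (x t) (Z t)) (christoffelMap _ _ _ _),
    metricForm_christoffelMap hφ hu]
  have hsymm : ∀ k v w : Euc n, fderiv ℝ (metricForm φ) (φ (x t)) k v w =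
      fderiv ℝ (metricForm φ) (φ (x t)) k w v := by
    intro k v w
    rw [trilinear_expand', trilinear_expand']
    refine Finset.sum_congr rfl fun m _ => ?_
    rw [Finset.sum_comm]
    congr 1
    refine Finset.sum_congr rfl fun i _ => Finset.sum_congr rfl fun j _ => ?_
    rw [← metricPartial_eq hφ hu, ← metricPartial_eq hφ hu]
    unfold metricPartial
    simp only [metricMatrix_symm _ i j, mul_comm]
  rw [hsymm _ (tangentCoord φ (x t) (W t)) (tangentCoord φ (x t) (Z t))]
  ring

theorem ac_inner_of_chart (hφ : φ ∈ atlas (Euc n) M) (hcd : c ≤ d)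
    (hs : ∀ t ∈ Icc c d, x t ∈ φ.source)
    (hx : AbsolutelyContinuousOnInterval (fun t => φ (x t)) c d)
    (hZ : AbsolutelyContinuousOnInterval (fun t => tangentCoord φ (x t) (Z t)) c d)
    (hW : AbsolutelyContinuousOnInterval (fun t => tangentCoord φ (x t) (W t)) c d) :
    AbsolutelyContinuousOnInterval (fun t => inner ℝ (Z t) (W t)) c d := by
  have h : ∀ i j, AbsolutelyContinuousOnInterval (fun t => metricMatrix φ (φ (x t)) i j) c d :=
    fun i j => hx.comp_contDiffOn (g := fun u => metricMatrix φ u i j) hcd φ.open_target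
      ((contDiffOn_metricMatrix hφ i j).of_le ENat.LEInfty.out)
      fun t ht => φ.map_source (hs t ht)
  have h1 : ∀ i j, AbsolutelyContinuousOnInterval (fun t => metricMatrix φ (φ (x t)) i j *
      (tangentCoord φ (x t) (Z t) i * tangentCoord φ (x t) (W t) j)) c d := fun i j =>
    (h i j).fun_mul ((hZ.coord i).fun_mul (hW.coord j))
  have h2 : AbsolutelyContinuousOnInterval (fun t => ∑ i, ∑ j, metricMatrix φ (φ (x t)) i j *
      (tangentCoord φ (x t) (Z t) i * tangentCoord φ (x t) (W t) j)) c d :=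
    .finset_sum _ fun i _ => .finset_sum _ fun j _ => h1 i j
  refine h2.congr fun t ht => ?_
  rw [uIcc_of_le hcd] at ht
  exact (inner_eq_sum_metricMatrix hφ (hs t ht) _ _).symm

theorem FieldOn.absolutelyContinuous_inner (hZ : FieldOn a b x Z) (hW : FieldOn a b x W)
    (hx : CurveOn n a b x) (hab : a ≤ b) :
    AbsolutelyContinuousOnInterval (fun t => inner ℝ (Z t) (W t)) a b := by
  refine AbsolutelyContinuousOnInterval.of_local hab fun t ht => ?_
  obtain ⟨U, hU, hUx⟩ := hx.exists_nhds_chart ht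
  refine ⟨U, hU, fun c d hcd h1 h2 => ?_⟩
  have hs : ∀ s ∈ Icc c d, x s ∈ (chartAt (Euc n) (x t)).source := fun s hs =>
    hUx s (h1 hs) (h2 hs)
  have hφ := chart_mem_atlas (Euc n) (x t)
  exact ac_inner_of_chart hφ hcd hs (hx.2 _ hφ c d hcd h1 hs) (hZ _ hφ c d hcd h1 hs)
    (hW _ hφ c d hcd h1 hs)

end

end Rolling

/-! ### Parallel frames along curves -/

namespace Rolling

noncomputable section

theorem integrableOn_continuousOn_clm_apply {F G : Type*} [NormedAddCommGroup F] [NormedSpace ℝ F]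
    [NormedAddCommGroup G] [NormedSpace ℝ G] {T : ℝ → F →L[ℝ] G} {v : ℝ → F} {a b : ℝ}
    (hT : ContinuousOn T (Icc a b)) (hv : IntegrableOn v (Icc a b)) :
    IntegrableOn (fun t => T t (v t)) (Icc a b) := by
  obtain ⟨C, hC⟩ := isCompact_Icc.exists_bound_of_continuousOn hT
  refine Integrable.mono' (hv.norm.const_mul C) ?_ ?_
  · exact (ContinuousLinearMap.id ℝ (F →L[ℝ] G)).aestronglyMeasurable_comp₂
      (hT.aestronglyMeasurable measurableSet_Icc) hv.aestronglyMeasurable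
  · filter_upwards [(ae_restrict_iff' measurableSet_Icc).2 (Filter.Eventually.of_forall hC)]
      with t ht
    exact (T t).le_of_opNorm_le ht _

/-- Frames are families over all of `ℝ`, but orthonormality is known only on an interval; the guard
`P` permits an arbitrary isometry elsewhere. With `P` false it merely supplies some isometry. -/
theorem exists_linearIsometryEquiv_of_orthonormal {n : ℕ} {V : Type*} [NormedAddCommGroup V]
    [InnerProductSpace ℝ V] [FiniteDimensional ℝ V] (hV : Module.finrank ℝ V = n) (P : Prop)
    {v : Fin n → V} (hv : P → Orthonormal ℝ v) :
    ∃ L : Euc n ≃ₗᵢ[ℝ] V, P → ∀ j, L (stdVec j) = v j := by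
  by_cases hP : P
  · obtain ⟨B, hB⟩ := Orthonormal.exists_orthonormalBasis_extension_of_card_eq
      (hV.trans (Fintype.card_fin n).symm) (v := v) (s := univ)
      ((hv hP).comp _ Subtype.val_injective)
    refine ⟨B.repr.symm, fun _ j => ?_⟩
    rw [stdVec, B.repr_symm_single, hB j (mem_univ _)]
  · exact ⟨((stdOrthonormalBasis ℝ V).reindex
      (Fintype.equivOfCardEq (by rw [Fintype.card_fin, Fintype.card_fin, hV]))).repr.symm,
      fun h => absurd h hP⟩

theorem inner_stdVec {n : ℕ} (i j : Fin n) :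
    inner ℝ (stdVec i : Euc n) (stdVec j) = if i = j then 1 else 0 :=
  orthonormal_iff_ite.1 EuclideanSpace.orthonormal_single i j

variable {n : ℕ} {M : Type*} [TopologicalSpace M] [ChartedSpace (Euc n) M]
  {x : ℝ → M} {Z W : ∀ t : ℝ, TangentSpace (𝓡 n) (x t)} {a b c d t : ℝ}
  {φ ψ : OpenPartialHomeomorph M (Euc n)}

theorem FieldOn.congr (hZ : FieldOn a b x Z) (h : ∀ t ∈ Icc a b, Z t = W t) :
    FieldOn a b x W := by
  intro φ hφ c d hcd h1 hs
  refine (hZ φ hφ c d hcd h1 hs).congr fun t ht => ?_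
  rw [uIcc_of_le hcd] at ht
  rw [h t (h1 ht)]

theorem FieldOn.trans (hZ : FieldOn a b x Z) (hZ' : FieldOn b c x Z) : FieldOn a c x Z := by
  intro φ hφ e f hef h1 hs
  have h1e := h1 ⟨le_rfl, hef⟩
  have h1f := h1 ⟨hef, le_rfl⟩
  rcases le_total f b with h | h
  · exact hZ φ hφ e f hef (Icc_subset_Icc h1e.1 h) hs
  · rcases le_total b e with h' | h'
    · exact hZ' φ hφ e f hef (Icc_subset_Icc h' h1f.2) hs
    · exact (hZ φ hφ e b h' (Icc_subset_Icc h1e.1 le_rfl)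
        fun t ht => hs t ⟨ht.1, ht.2.trans h⟩).trans
        (hZ' φ hφ b f h (Icc_subset_Icc le_rfl h1f.2) fun t ht => hs t ⟨h'.trans ht.1, ht.2⟩) h' h

variable [RiemannianBundle (fun p : M => TangentSpace (𝓡 n) p)]

/-- `Z` is parallel along `x` on `[a, b]`. -/
def ParallelOn (a b : ℝ) (x : ℝ → M) (Z : ∀ t : ℝ, TangentSpace (𝓡 n) (x t)) : Prop :=
  FieldOn a b x Z ∧ ∀ᵐ t : ℝ, t ∈ Icc a b → covDeriv x Z t = 0

theorem ParallelOn.congr (hZ : ParallelOn a b x Z) (h : ∀ t ∈ Icc a b, Z t = W t) :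
    ParallelOn a b x W := by
  refine ⟨hZ.1.congr h, ?_⟩
  filter_upwards [hZ.2, ae_mem_Ioo a b] with t h1 h2 ht
  rw [← h1 ht]
  refine covDeriv_congr ?_
  filter_upwards [Icc_mem_nhds (h2 ht).1 (h2 ht).2] with s hs
  exact (h s hs).symm

theorem ParallelOn.trans (hZ : ParallelOn a b x Z) (hZ' : ParallelOn b c x Z) :
    ParallelOn a c x Z := by
  refine ⟨hZ.1.trans hZ'.1, ?_⟩
  filter_upwards [hZ.2, hZ'.2] with t h1 h2 ht
  rcases le_total t b with h | h
  · exact h1 ⟨ht.1, h⟩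
  · exact h2 ⟨h, ht.2⟩

/-- The algebraic structure here comes from the Riemannian norm and has to be identified with that
of the underlying `ℝⁿ`. -/
theorem finiteDimensional_tangentSpace (p : M) :
    @FiniteDimensional ℝ (TangentSpace (𝓡 n) p) _ NormedAddCommGroup.toAddCommGroup
      NormedSpace.toModule :=
  inferInstanceAs (FiniteDimensional ℝ (Euc n))

theorem finrank_tangentSpace (p : M) :
    @Module.finrank ℝ (TangentSpace (𝓡 n) p) _ NormedAddCommGroup.toAddCommGroup.toAddCommMonoid
      NormedSpace.toModule = n :=
  finrank_euclideanSpace_fin (𝕜 := ℝ) (n := n)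

/-- An orthonormal family of `n` tangent vectors is a frame. -/
theorem exists_frame_of_orthonormal (p : M) (P : Prop) {v : Fin n → TangentSpace (𝓡 n) p}
    (hv : P → Orthonormal ℝ v) :
    ∃ L : Euc n ≃ₗᵢ[ℝ] TangentSpace (𝓡 n) p, P → ∀ j, L (stdVec j) = v j := by
  have h1 := finiteDimensional_tangentSpace (n := n) p
  have h2 := finrank_tangentSpace (n := n) p
  exact @exists_linearIsometryEquiv_of_orthonormal n (TangentSpace (𝓡 n) p) _ _ h1 h2 P v hv

theorem linearIsometryEquiv_ext_stdVec {p : M} {L L' : Euc n ≃ₗᵢ[ℝ] TangentSpace (𝓡 n) p}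
    (h : ∀ j, L (stdVec j) = L' (stdVec j)) : L = L' := by
  ext v
  rw [← sum_coord_smul_stdVec v]
  simp only [map_sum, map_smul, h]

variable [IsManifold (𝓡 n) ∞ M]
  [IsContMDiffRiemannianBundle (𝓡 n) ∞ (EuclideanSpace ℝ (Fin n))
      (fun p : M => TangentSpace (𝓡 n) p)]

/-- The inner product is absolutely continuous, and by metric compatibility its derivative vanishes
almost everywhere. -/
theorem ParallelOn.inner_eq (hZ : ParallelOn a b x Z) (hW : ParallelOn a b x W)
    (hx : CurveOn n a b x) (hab : a ≤ b) (ht : t ∈ Icc a b) :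
    inner ℝ (Z t) (W t) = inner ℝ (Z a) (W a) := by
  refine (hZ.1.absolutelyContinuous_inner hW.1 hx hab).eq_of_ae_hasDerivAt_zero hab ?_ ht
  filter_upwards [hx.ae_curveDiffAt hab, hZ.1.ae_fieldDiffAt hx hab,
    hW.1.ae_fieldDiffAt hx hab, hZ.2, hW.2] with t h1 h2 h3 h4 h5 ht
  have h := hasDerivAt_inner (h1 ht).2 (h2 ht) (h3 ht)
  rwa [h4 ht, h5 ht, inner_zero_left, inner_zero_right, add_zero] at h

/-- Parallel transport inside a chart. -/
theorem exists_parallelOn_of_chart (hφ : φ ∈ atlas (Euc n) M) (hx : CurveOn n a b x) (hab : a ≤ b)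
    (hs : ∀ t ∈ Icc a b, x t ∈ φ.source) (v : TangentSpace (𝓡 n) (x a)) :
    ∃ Z : ∀ t : ℝ, TangentSpace (𝓡 n) (x t), Z a = v ∧ ParallelOn a b x Z := by
  have hu := hx.2 φ hφ a b hab Subset.rfl hs
  have hu' : IntegrableOn (deriv fun t => φ (x t)) (Icc a b) := by
    have := hu.intervalIntegrable_deriv_euclidean
    rwa [intervalIntegrable_iff', uIcc_of_le hab] at this
  have huc : ContinuousOn (fun t => φ (x t)) (Icc a b) := by
    simpa [uIcc_of_le hab] using hu.continuousOn
  have hΓ : ContinuousOn (fun t => christoffelMap φ (φ (x t))) (Icc a b) :=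
    (continuousOn_christoffelMap hφ).comp huc fun t ht => φ.map_source (hs t ht)
  -- In the chart, parallelism reads `z' = -Γ(u)(u', z)`: the coefficient is a continuous factor
  -- applied to an integrable one.
  have hA := (integrableOn_continuousOn_clm_apply hΓ hu').neg
  obtain ⟨z, hz, hz'⟩ := exists_linear_integral_eq hab hA (tangentCoord φ (x a) v)
  have hAz := integrableOn_clm_apply hA hz.continuousOn
  have hAz' : IntervalIntegrable (fun s => (-fun t => christoffelMap φ (φ (x t))
      (deriv (fun t => φ (x t)) t)) s (z s)) volume a b := by
    rwa [intervalIntegrable_iff', uIcc_of_le hab]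
  have hzac : AbsolutelyContinuousOnInterval z a b := by
    refine ((AbsolutelyContinuousOnInterval.const_fun (tangentCoord φ (x a) v) a b).fun_add
      hAz'.absolutelyContinuousOnInterval_integral_euclidean).congr fun t ht => ?_
    rw [uIcc_of_le hab] at ht
    exact (hz' t ht).symm
  have hcoord : ∀ t ∈ Icc a b, tangentCoord φ (x t) (ofCoord φ (x t) (z t)) = z t :=
    fun t ht => tangentCoord_ofCoord hφ (hs t ht) _
  have hac : AbsolutelyContinuousOnInterval
      (fun t => tangentCoord φ (x t) (ofCoord φ (x t) (z t))) a b :=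
    hzac.congr fun t ht => (hcoord t (by rwa [uIcc_of_le hab] at ht)).symm
  refine ⟨fun t => ofCoord φ (x t) (z t), ?_, ?_, ?_⟩
  · have := hz' a ⟨le_rfl, hab⟩
    rw [intervalIntegral.integral_same, add_zero] at this
    simp only [this]
    exact ofCoord_tangentCoord hφ (hs a ⟨le_rfl, hab⟩) v
  · intro ψ hψ c d hcd h1 hs'
    refine ac_tangentCoord_of_chart hφ hψ hcd (fun t ht => hs t (h1 ht)) hs'
      (hx.2 φ hφ c d hcd h1 fun t ht => hs t (h1 ht)) (hac.mono ?_)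
    rwa [uIcc_of_le hab, uIcc_of_le hcd]
  · filter_upwards [hx.ae_curveDiffAt hab, hAz'.ae_hasDerivAt_integral] with t h1 h2 ht
    obtain ⟨h3, h4⟩ := h1 ht
    have h5 : HasDerivAt (fun t => tangentCoord φ (x t) (ofCoord φ (x t) (z t)))
        (-christoffelMap φ (φ (x t)) (deriv (fun t => φ (x t)) t) (z t)) t := by
      have h6 := (h2 (by rwa [uIcc_of_le hab]) a left_mem_uIcc).const_add (tangentCoord φ (x a) v)
      refine h6.congr_of_eventuallyEq ?_
      filter_upwards [Icc_mem_nhds h3.1 h3.2] with s hs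
      rw [hcoord s hs, hz' s hs]
    have h7 := h4.2 φ hφ (hs t ht)
    rw [covDeriv_eq_covDerivIn hφ h4
      (.of_chart hφ h4.1 (hs t ht) h7 h5.differentiableAt) (hs t ht), covDerivIn_eq, h5.deriv,
      hcoord t ht, neg_add_cancel]
    exact map_zero (mfderiv (𝓡 n) (𝓡 n) φ (x t)).inverse

/-- Parallel transport of an orthonormal frame along an absolutely continuous curve. -/
theorem exists_parallel_frame (hx : CurveOn n a b x) (hab : a ≤ b)
    (f₀ : Euc n ≃ₗᵢ[ℝ] TangentSpace (𝓡 n) (x a)) :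
    ∃ f : ∀ t : ℝ, Euc n ≃ₗᵢ[ℝ] TangentSpace (𝓡 n) (x t),
      f a = f₀ ∧ ∀ j, ParallelOn a b x fun t => f t (stdVec j) := by
  refine interval_induction hab (fun c d => ∀ f₀ : Euc n ≃ₗᵢ[ℝ] TangentSpace (𝓡 n) (x c),
    ∃ f : ∀ t : ℝ, Euc n ≃ₗᵢ[ℝ] TangentSpace (𝓡 n) (x t),
      f c = f₀ ∧ ∀ j, ParallelOn c d x fun t => f t (stdVec j)) ?_ ?_ f₀
  · intro c d e _ hcd hde _ h1 h2 f₀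
    obtain ⟨f, hf, hf'⟩ := h1 f₀
    obtain ⟨g, hg, hg'⟩ := h2 (f d)
    refine ⟨fun t => if t ≤ d then f t else g t, by simp [hcd, hf], fun j => ?_⟩
    refine ((hf' j).congr fun t ht => ?_).trans ((hg' j).congr fun t ht => ?_)
    · simp [ht.2]
    · rcases ht.1.eq_or_lt with h | h
      · subst h
        simp [hg]
      · simp [not_le.2 h]
  · intro t ht
    obtain ⟨U, hU, hUx⟩ := hx.exists_nhds_chart ht
    refine ⟨U, hU, fun c d hcd h1 h2 f₀ => ?_⟩
    have hx' := hx.mono h1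
    have h3 := fun j => exists_parallelOn_of_chart (chart_mem_atlas (Euc n) (x t)) hx' hcd
      (fun s hs => hUx s (h1 hs) (h2 hs)) (f₀ (stdVec j))
    choose Z hZ hZ' using h3
    -- The vectors are transported one by one; constancy of their inner products keeps them
    -- orthonormal.
    have hon : ∀ s, s ∈ Icc c d → Orthonormal ℝ fun j => Z j s := by
      intro s hs
      rw [orthonormal_iff_ite]
      intro i j
      rw [(hZ' i).inner_eq (hZ' j) hx' hcd hs, hZ, hZ, LinearIsometryEquiv.inner_map_map,
        inner_stdVec]
    choose f hf using fun s => exists_frame_of_orthonormal (x s) (s ∈ Icc c d) (hon s)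
    refine ⟨f, linearIsometryEquiv_ext_stdVec fun j => ?_, fun j => ?_⟩
    · rw [hf c ⟨le_rfl, hcd⟩, hZ]
    · exact (hZ' j).congr fun s hs => (hf s hs j).symm

end

end Rolling

/-! ### Orientations -/

namespace Rolling

noncomputable section

theorem orientation_map_trans {ι V W X : Type*} [AddCommGroup V] [AddCommGroup W] [AddCommGroup X]
    [Module ℝ V] [Module ℝ W] [Module ℝ X] (e : V ≃ₗ[ℝ] W) (f : W ≃ₗ[ℝ] X)
    (σ : Orientation ℝ V ι) :
    Orientation.map ι (e.trans f) σ = Orientation.map ι f (Orientation.map ι e σ) := by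
  induction σ using Module.Ray.ind with
  | h v hv => rfl

/-- The determinant of `L'⁻¹ L` is `det L * det L'` times a nonzero square. -/
theorem orientation_map_eq_of_det_mul_pos {n : ℕ} (L L' : Euc n ≃ₗ[ℝ] Euc n)
    (h : 0 < LinearMap.det (L : Euc n →ₗ[ℝ] Euc n) * LinearMap.det (L' : Euc n →ₗ[ℝ] Euc n))
    (σ : Orientation ℝ (Euc n) (Fin n)) :
    Orientation.map (Fin n) L σ = Orientation.map (Fin n) L' σ := by
  have h1 : Orientation.map (Fin n) (L.trans L'.symm) σ = σ := by
    rw [Orientation.map_eq_iff_det_pos _ _ (by simp)]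
    have h2 : ((L.trans L'.symm : Euc n ≃ₗ[ℝ] Euc n) : Euc n →ₗ[ℝ] Euc n) =
      (L'.symm : Euc n →ₗ[ℝ] Euc n) ∘ₗ (L : Euc n →ₗ[ℝ] Euc n) := rfl
    have h3 := L'.det_symm_mul_det
    rw [h2, LinearMap.det_comp]
    have h4 : LinearMap.det (L'.symm : Euc n →ₗ[ℝ] Euc n) ≠ 0 := left_ne_zero_of_mul_eq_one h3
    have h5 : LinearMap.det (L'.symm : Euc n →ₗ[ℝ] Euc n) * LinearMap.det (L : Euc n →ₗ[ℝ] Euc n) =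
      LinearMap.det (L'.symm : Euc n →ₗ[ℝ] Euc n) ^ 2 *
        (LinearMap.det (L : Euc n →ₗ[ℝ] Euc n) * LinearMap.det (L' : Euc n →ₗ[ℝ] Euc n)) := by
      linear_combination -LinearMap.det (L'.symm : Euc n →ₗ[ℝ] Euc n) *
        LinearMap.det (L : Euc n →ₗ[ℝ] Euc n) * h3
    rw [h5]
    positivity
  conv_rhs => rw [← h1, ← orientation_map_trans]
  have h2 : (L.trans L'.symm).trans L' = L := by
    ext v
    simp
  rw [h2]

theorem linearMap_det_eq {n : ℕ} (L : Euc n ≃ₗ[ℝ] Euc n) :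
    LinearMap.det (L : Euc n →ₗ[ℝ] Euc n) = (Matrix.of fun i j => L (stdVec j) i).det := by
  rw [← LinearMap.det_toMatrix (EuclideanSpace.basisFun (Fin n) ℝ).toBasis]
  congr 1

theorem toEuclideanLin_stdVec {n : ℕ} (ι : Matrix (Fin n) (Fin n) ℝ) (i j : Fin n) :
    Matrix.toEuclideanLin ι (stdVec j) i = ι i j := by
  simp [Matrix.toLpLin_apply, stdVec]

theorem linearMap_ext_stdVec {n : ℕ} {V : Type*} [AddCommGroup V] [Module ℝ V]
    {L L' : Euc n →ₗ[ℝ] V} (h : ∀ j, L (stdVec j) = L' (stdVec j)) (v : Euc n) : L v = L' v := by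
  rw [← sum_coord_smul_stdVec v]
  simp only [map_sum, map_smul, h]

theorem exists_isometry_of_mem_specialOrthogonalGroup {n : ℕ} {ι : Matrix (Fin n) (Fin n) ℝ}
    (h : ι ∈ Matrix.specialOrthogonalGroup (Fin n) ℝ) : ∃ L : Euc n ≃ₗᵢ[ℝ] Euc n,
      (∀ v, L v = Matrix.toEuclideanLin ι v) ∧
        Orientation.map (Fin n) L.toLinearEquiv (stdOrientation n) = stdOrientation n := by
  rw [Matrix.mem_specialOrthogonalGroup_iff, Matrix.mem_orthogonalGroup_iff'] at h
  have hon : Orthonormal ℝ fun j => Matrix.toEuclideanLin ι (stdVec j) := by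
    rw [orthonormal_iff_ite]
    intro i j
    rw [PiLp.inner_apply]
    simp only [toEuclideanLin_stdVec, RCLike.inner_apply, conj_trivial]
    rw [← Matrix.one_apply, ← h.1, Matrix.mul_apply]
    refine Finset.sum_congr rfl fun k _ => ?_
    rw [Matrix.transpose_apply, mul_comm]
  obtain ⟨L, hL⟩ := exists_linearIsometryEquiv_of_orthonormal finrank_euclideanSpace_fin True
    fun _ => hon
  have hL' : ∀ v, L v = Matrix.toEuclideanLin ι v :=
    linearMap_ext_stdVec (L := (L.toLinearEquiv : Euc n →ₗ[ℝ] Euc n)) (hL trivial)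
  refine ⟨L, hL', ?_⟩
  rw [Orientation.map_eq_iff_det_pos _ _ (by simp), linearMap_det_eq]
  have h1 : (Matrix.of fun i j => L.toLinearEquiv (stdVec j) i) = ι := by
    ext i j
    rw [Matrix.of_apply, ← toEuclideanLin_stdVec ι i j]
    exact congrArg (fun v : Euc n => v i) (hL' (stdVec j))
  rw [h1, h.2]
  exact one_pos

theorem exists_mem_specialOrthogonalGroup {n : ℕ} (L : Euc n ≃ₗᵢ[ℝ] Euc n)
    (h : Orientation.map (Fin n) L.toLinearEquiv (stdOrientation n) = stdOrientation n) :
    ∃ ι ∈ Matrix.specialOrthogonalGroup (Fin n) ℝ, ∀ v, Matrix.toEuclideanLin ι v = L v := by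
  have h1 : (Matrix.of fun i j => L (stdVec j) i).transpose *
      (Matrix.of fun i j => L (stdVec j) i) = 1 := by
    ext i j
    rw [Matrix.one_apply, ← inner_stdVec, ← L.inner_map_map, PiLp.inner_apply, Matrix.mul_apply]
    refine Finset.sum_congr rfl fun k _ => ?_
    simp [mul_comm]
  refine ⟨Matrix.of fun i j => L (stdVec j) i, ?_, ?_⟩
  · rw [Matrix.mem_specialOrthogonalGroup_iff, Matrix.mem_orthogonalGroup_iff']
    refine ⟨h1, ?_⟩
    rw [Orientation.map_eq_iff_det_pos _ _ (by simp), linearMap_det_eq] at h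
    have h2 := congrArg Matrix.det h1
    rw [Matrix.det_mul, Matrix.det_transpose, Matrix.det_one, ← sq] at h2
    have h4 : 0 < (Matrix.of fun i j => L (stdVec j) i).det := h
    exact (pow_eq_one_iff_of_nonneg h4.le two_ne_zero).1 h2
  · refine linearMap_ext_stdVec (L' := (L.toLinearEquiv : Euc n →ₗ[ℝ] Euc n)) fun j => ?_
    ext i
    rw [toEuclideanLin_stdVec]
    rfl

variable {n : ℕ} {M : Type*} [TopologicalSpace M] [ChartedSpace (Euc n) M]
  {x : ℝ → M} {Z W : ∀ t : ℝ, TangentSpace (𝓡 n) (x t)} {a b c d t : ℝ}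
  {φ ψ : OpenPartialHomeomorph M (Euc n)} [IsManifold (𝓡 n) ∞ M]

omit [IsManifold (𝓡 n) ∞ M] in
theorem FieldOn.continuousWithinAt (hZ : FieldOn a b x Z) (hx : CurveOn n a b x)
    (ht : t ∈ Icc a b) :
    ContinuousWithinAt (fun s => tangentCoord (chartAt (Euc n) (x t)) (x s) (Z s)) (Icc a b) t := by
  obtain ⟨U, hU, hUx⟩ := hx.exists_nhds_chart ht
  obtain ⟨r, hr, hrU⟩ := Metric.mem_nhds_iff.1 hU
  have hI : Icc (t - r / 2) (t + r / 2) ∈ 𝓝 t := Icc_mem_nhds (by linarith) (by linarith)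
  -- A closed interval inside the chart that is a neighbourhood of `t` relative to `[a, b]`, also
  -- when `t` is an endpoint.
  have hcd : max a (t - r / 2) ≤ min b (t + r / 2) :=
    max_le (le_min (ht.1.trans ht.2) (by linarith [ht.1])) (le_min (by linarith [ht.2])
      (by linarith))
  have hsub : Icc (max a (t - r / 2)) (min b (t + r / 2)) ⊆ Icc a b :=
    Icc_subset_Icc (le_max_left _ _) (min_le_left _ _)
  have h := (hZ _ (chart_mem_atlas _ (x t)) _ _ hcd hsub fun s hs => hUx s (hsub hs) (hrU (by
    rw [Metric.mem_ball, Real.dist_eq, abs_lt]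
    have h1 := (le_max_right _ _).trans hs.1
    have h2 := hs.2.trans (min_le_right _ _)
    constructor <;> linarith))).continuousOn
  rw [uIcc_of_le hcd, ← Icc_inter_Icc] at h
  exact (h t ⟨ht, mem_of_mem_nhds hI⟩).mono_of_mem_nhdsWithin
    (Filter.inter_mem self_mem_nhdsWithin (mem_nhdsWithin_of_mem_nhds hI))

variable [RiemannianBundle (fun p : M => TangentSpace (𝓡 n) p)]

/-- Frames that depend continuously on time keep their orientation. -/
theorem map_frame_orientation_eq (o : ManifoldOrientation n M) (hx : CurveOn n a b x)
    {f : ∀ t : ℝ, Euc n ≃ₗᵢ[ℝ] TangentSpace (𝓡 n) (x t)}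
    (hf : ∀ j, FieldOn a b x fun t => f t (stdVec j)) {σ : Orientation ℝ (Euc n) (Fin n)}
    (ha : Orientation.map (Fin n) (f a).toLinearEquiv σ = o.at_ (x a)) (ht : t ∈ Icc a b) :
    Orientation.map (Fin n) (f t).toLinearEquiv σ = o.at_ (x t) := by
  refine interval_induction (ht.1.trans ht.2) (fun c d =>
    Orientation.map (Fin n) (f c).toLinearEquiv σ = o.at_ (x c) → ∀ s ∈ Icc c d,
      Orientation.map (Fin n) (f s).toLinearEquiv σ = o.at_ (x s)) ?_ ?_ ha t ht
  · intro c d e _ hcd _ _ h1 h2 hc s hs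
    rcases le_total s d with h | h
    · exact h1 hc s ⟨hs.1, h⟩
    · exact h2 (h1 hc d ⟨hcd, le_rfl⟩) s ⟨h, hs.2⟩
  · intro t ht
    set φ := chartAt (Euc n) (x t)
    have hφ : φ ∈ atlas (Euc n) M := chart_mem_atlas _ _
    have hs : x t ∈ φ.source := mem_chart_source _ _
    -- The determinant of the frame read in the chart: continuous at `t` and nonzero there, so its
    -- sign is constant near `t`.
    let D : ℝ → ℝ := fun s => (Matrix.of fun i j => tangentCoord φ (x s) (f s (stdVec j)) i).det
    have hD : ContinuousWithinAt D (Icc a b) t := by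
      have h1 : ContinuousWithinAt (fun s => (Matrix.of fun i j : Fin n =>
          tangentCoord φ (x s) (f s (stdVec j)) i)) (Icc a b) t := by
        refine continuousWithinAt_pi.2 fun i => continuousWithinAt_pi.2 fun j => ?_
        exact (EuclideanSpace.proj i : Euc n →L[ℝ] ℝ).continuous.continuousAt.comp_continuousWithinAt
          ((hf j).continuousWithinAt hx ht)
      exact (continuous_id.matrix_det
        (A := fun A : Matrix (Fin n) (Fin n) ℝ => A)).continuousAt.comp_continuousWithinAt h1
    have hdet : ∀ s (hs : x s ∈ φ.source), LinearMap.det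
        (((f s).toLinearEquiv.trans (chartEquiv hφ hs) : Euc n ≃ₗ[ℝ] Euc n) :
          Euc n →ₗ[ℝ] Euc n) = D s := fun s hs => linearMap_det_eq _
    have hD0 : D t ≠ 0 := by
      rw [← hdet t hs]
      exact (LinearEquiv.isUnit_det' _).ne_zero
    have hpos : ∀ᶠ s in 𝓝[Icc a b] t, 0 < D s * D t :=
      (hD.mul_const (D t)).eventually_const_lt 
        (show 0 < D t * D t from mul_self_pos.2 hD0)
    have hloc : ∀ᶠ s in 𝓝[Icc a b] t, ∀ hs' : x s ∈ φ.source,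
        Orientation.map (Fin n) (chartEquiv hφ hs') (o.at_ (x s)) =
          Orientation.map (Fin n) (chartEquiv hφ hs) (o.at_ (x t)) :=
      (hx.1 t ht).eventually (o.locallyConstant φ hφ (x t) hs)
    have hsrc : ∀ᶠ s in 𝓝[Icc a b] t, x s ∈ φ.source :=
      (hx.1 t ht).eventually (φ.open_source.mem_nhds hs)
    -- An equivalence, because the orientation has to pass from `c` to `t` and then from `t` to `s`.
    have key : ∀ᶠ s in 𝓝[Icc a b] t,
        (Orientation.map (Fin n) (f s).toLinearEquiv σ = o.at_ (x s) ↔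
          Orientation.map (Fin n) (f t).toLinearEquiv σ = o.at_ (x t)) := by
      filter_upwards [hpos, hloc, hsrc] with s h1 h2 h3
      rw [← (Orientation.map (Fin n) (chartEquiv hφ h3)).injective.eq_iff,
        ← (Orientation.map (Fin n) (chartEquiv hφ hs)).injective.eq_iff, h2 h3,
        ← orientation_map_trans, ← orientation_map_trans,
        orientation_map_eq_of_det_mul_pos _ ((f t).toLinearEquiv.trans (chartEquiv hφ hs))
          (by rw [hdet s h3, hdet t hs]; exact h1)]
    obtain ⟨U, hU, hU'⟩ := mem_nhdsWithin_iff_exists_mem_nhds_inter.1 key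
    refine ⟨U, hU, fun c d hcd h1 h2 hc s hs => ?_⟩
    have hc' : c ∈ Icc c d := ⟨le_rfl, hcd⟩
    exact (hU' ⟨h2 hs, h1 hs⟩).2 ((hU' ⟨h2 hc', h1 hc'⟩).1 hc)

end

end Rolling

/-! ### Uniqueness of parallel frames, and anti-developments -/

namespace Rolling

noncomputable section

theorem linearIsometryEquiv_symm_coord {n : ℕ} {V : Type*} [NormedAddCommGroup V]
    [InnerProductSpace ℝ V] (L : Euc n ≃ₗᵢ[ℝ] V) (v : V) (k : Fin n) :
    L.symm v k = inner ℝ (L (stdVec k)) v := by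
  have h := L.inner_map_map (stdVec k) (L.symm v)
  rw [L.apply_symm_apply] at h
  rw [h, EuclideanSpace.inner_single_left, map_one, one_mul]

theorem eq_of_inner_frame {n : ℕ} {V : Type*} [NormedAddCommGroup V]
    [InnerProductSpace ℝ V] (L : Euc n ≃ₗᵢ[ℝ] V) {v w : V}
    (h : ∀ k, inner ℝ (L (stdVec k)) v = inner ℝ (L (stdVec k)) w) : v = w := by
  refine L.symm.injective (PiLp.ext fun k => ?_)
  rw [linearIsometryEquiv_symm_coord, linearIsometryEquiv_symm_coord, h]

theorem symm_trans_apply_eq_sum {n : ℕ} {V W : Type*} [NormedAddCommGroup V]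
    [InnerProductSpace ℝ V] [NormedAddCommGroup W] [InnerProductSpace ℝ W]
    (L : Euc n ≃ₗᵢ[ℝ] V) (L' : Euc n ≃ₗᵢ[ℝ] W) (v : V) :
    L.symm.trans L' v = ∑ k, (inner ℝ (L (stdVec k)) v : ℝ) • L' (stdVec k) := by
  rw [LinearIsometryEquiv.trans_apply, ← sum_coord_smul_stdVec (L.symm v), map_sum]
  refine Finset.sum_congr rfl fun k _ => ?_
  rw [map_smul, linearIsometryEquiv_symm_coord]

variable {n : ℕ} {M : Type*} [TopologicalSpace M] [ChartedSpace (Euc n) M]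
  {x : ℝ → M} {Z W : ∀ t : ℝ, TangentSpace (𝓡 n) (x t)} {a b c d t : ℝ}
  {φ ψ : OpenPartialHomeomorph M (Euc n)}
  [RiemannianBundle (fun p : M => TangentSpace (𝓡 n) p)] [IsManifold (𝓡 n) ∞ M]
  [IsContMDiffRiemannianBundle (𝓡 n) ∞ (EuclideanSpace ℝ (Fin n))
      (fun p : M => TangentSpace (𝓡 n) p)]
  {f g : ∀ t : ℝ, Euc n ≃ₗᵢ[ℝ] TangentSpace (𝓡 n) (x t)}

/-- Two parallel frames differ by a constant isometry. -/
theorem parallel_frame_eq (hx : CurveOn n a b x) (hab : a ≤ b)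
    (hf : ∀ j, ParallelOn a b x fun t => f t (stdVec j))
    (hg : ∀ j, ParallelOn a b x fun t => g t (stdVec j)) (ht : t ∈ Icc a b) :
    g t = ((g a).trans (f a).symm).trans (f t) := by
  -- The matrix of `g` relative to `f` consists of inner products of parallel fields, hence is
  -- constant.
  refine linearIsometryEquiv_ext_stdVec fun j => eq_of_inner_frame (f t) fun k => ?_
  rw [(hf k).inner_eq (hg j) hx hab ht, LinearIsometryEquiv.trans_apply,
    LinearIsometryEquiv.inner_map_map, ← (f a).inner_map_map, LinearIsometryEquiv.trans_apply,
    LinearIsometryEquiv.apply_symm_apply]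

/-- Transporting the rotated initial frame gives a parallel frame, which uniqueness identifies with
the rotated `f`. -/
theorem parallelOn_frame_comp (hx : CurveOn n a b x) (hab : a ≤ b)
    (hf : ∀ j, ParallelOn a b x fun t => f t (stdVec j)) (L : Euc n ≃ₗᵢ[ℝ] Euc n) (j : Fin n) :
    ParallelOn a b x fun t => f t (L (stdVec j)) := by
  obtain ⟨g, hga, hg⟩ := exists_parallel_frame hx hab (L.trans (f a))
  refine (hg j).congr fun t ht => ?_
  rw [parallel_frame_eq hx hab hf hg ht, hga]
  simp

/-- The velocity read in a frame is integrable. -/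
theorem integrableOn_frame_symm_velocity (hx : CurveOn n a b x) (hab : a ≤ b)
    (hf : ∀ j, FieldOn a b x fun t => f t (stdVec j)) :
    IntegrableOn (fun t => (f t).symm (velocity x t)) (Icc a b) := by
  refine interval_induction hab (fun c d =>
    IntegrableOn (fun t => (f t).symm (velocity x t)) (Icc c d)) ?_ ?_
  · intro c d e _ hcd hde _ h1 h2
    rw [← Icc_union_Icc_eq_Icc hcd hde]
    exact h1.union h2
  · intro t ht
    obtain ⟨U, hU, hUx⟩ := hx.exists_nhds_chart ht
    refine ⟨U, hU, fun c d hcd h1 h2 => ?_⟩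
    set φ := chartAt (Euc n) (x t)
    have hφ : φ ∈ atlas (Euc n) M := chart_mem_atlas _ _
    have hs : ∀ s ∈ Icc c d, x s ∈ φ.source := fun s hs => hUx s (h1 hs) (h2 hs)
    have hu := hx.2 φ hφ c d hcd h1 hs
    have hu' : IntegrableOn (deriv fun t => φ (x t)) (Icc c d) := by
      have := hu.intervalIntegrable_deriv_euclidean
      rwa [intervalIntegrable_iff', uIcc_of_le hcd] at this
    have huc : ContinuousOn (fun t => φ (x t)) (Icc c d) := by
      simpa [uIcc_of_le hcd] using hu.continuousOn
    have hG : ContinuousOn (fun t => metricForm φ (φ (x t))) (Icc c d) :=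
      (contDiffOn_metricForm hφ).continuousOn.comp huc fun t ht => φ.map_source (hs t ht)
    refine Integrable.of_eval_piLp fun k => ?_
    have hfk : ContinuousOn (fun s => tangentCoord φ (x s) (f s (stdVec k))) (Icc c d) := by
      simpa [uIcc_of_le hcd] using (hf k φ hφ c d hcd h1 hs).continuousOn
    -- The `k`-th component is the inner product of the `k`-th frame vector with the velocity: in
    -- the chart, a continuous covector applied to the integrable derivative.
    have h3 := integrableOn_continuousOn_clm_apply (hG.clm_apply hfk) hu'
    refine h3.congr ?_
    refine (ae_restrict_iff' measurableSet_Icc).2 ?_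
    filter_upwards [(hx.mono h1).ae_curveDiffAt hcd] with s h4 hscd
    have h5 := (h4 hscd).2
    rw [linearIsometryEquiv_symm_coord, inner_eq_metricForm hφ (hs s hscd),
      tangentCoord_velocity hφ h5.1 (h5.2 φ hφ (hs s hscd)) (hs s hscd)]

/-- A frame along `x` develops `x` into `ℝⁿ`. -/
theorem exists_antiDevelopment_of_frame (hx : CurveOn n a b x) (hab : a ≤ b)
    (hf : ∀ j, FieldOn a b x fun t => f t (stdVec j)) :
    ∃ y : ℝ → Euc n, AbsolutelyContinuousOnInterval y a b ∧ y a = 0 ∧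
      ∀ᵐ t : ℝ, t ∈ Icc a b → f t (deriv y t) = velocity x t := by
  have h := integrableOn_frame_symm_velocity hx hab hf
  have h' : IntervalIntegrable (fun t => (f t).symm (velocity x t)) volume a b := by
    rwa [intervalIntegrable_iff', uIcc_of_le hab]
  refine ⟨_, h'.absolutelyContinuousOnInterval_integral_euclidean, by simp, ?_⟩
  filter_upwards [h'.ae_hasDerivAt_integral] with t h1 ht
  rw [(h1 (by rwa [uIcc_of_le hab]) a left_mem_uIcc).deriv, LinearIsometryEquiv.apply_symm_apply]

end

end Rolling

/-! ### Rollings and parallel frames -/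

namespace Rolling

noncomputable section

variable {n : ℕ} {M : Type*} [TopologicalSpace M] [ChartedSpace (Euc n) M]
  [IsManifold (𝓡 n) ∞ M] [RiemannianBundle (fun p : M => TangentSpace (𝓡 n) p)]
  {N : Type*} [TopologicalSpace N] [ChartedSpace (Euc n) N]
  [IsManifold (𝓡 n) ∞ N] [RiemannianBundle (fun p : N => TangentSpace (𝓡 n) p)]
  {x : ℝ → M} {x' : ℝ → N} {a b τ : ℝ} {Z : ∀ t : ℝ, TangentSpace (𝓡 n) (x t)}
  {q : ∀ t : ℝ, TangentSpace (𝓡 n) (x t) ≃ₗᵢ[ℝ] TangentSpace (𝓡 n) (x' t)}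
  {o : ManifoldOrientation n M} {o' : ManifoldOrientation n N}
  {f : ∀ t : ℝ, Euc n ≃ₗᵢ[ℝ] TangentSpace (𝓡 n) (x t)}

/-- Expand `Z` in the coordinate fields: its components and the columns of the matrix of `q` are all
absolutely continuous. -/
theorem FieldOn.map_isometry (hx : CurveOn n a b x) (hx' : CurveOn n a b x')
    (hq : ∀ φ ∈ atlas (Euc n) M, ∀ ψ ∈ atlas (Euc n) N, ∀ c d : ℝ, c ≤ d → Icc c d ⊆ Icc a b →
      (∀ t ∈ Icc c d, x t ∈ φ.source ∧ x' t ∈ ψ.source) → ∀ j : Fin n,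
        AbsolutelyContinuousOnInterval
          (fun t => tangentCoord ψ (x' t) (q t (ofCoord φ (x t) (stdVec j)))) c d)
    (hZ : FieldOn a b x Z) : FieldOn a b x' fun t => q t (Z t) := by
  refine FieldOn.of_local hx' fun t ht => ?_
  obtain ⟨U, hU, hUx⟩ := hx.exists_nhds_chart ht
  refine ⟨U, hU, fun c d hcd h1 h2 hs' => ?_⟩
  have hs := fun s hs => hUx s (h1 hs) (h2 hs)
  have hφ := chart_mem_atlas (Euc n) (x t)
  refine (AbsolutelyContinuousOnInterval.finset_sum Finset.univ fun j _ =>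
    ((hZ _ hφ c d hcd h1 hs).coord j).fun_smul (hq _ hφ _ (chart_mem_atlas (Euc n) (x' t)) c d hcd h1
      (fun s h => ⟨hs s h, hs' s h⟩) j)).congr fun s h => ?_
  rw [uIcc_of_le hcd] at h
  conv_rhs => rw [ofCoord_sum_smul hφ (hs s h) (Z s)]
  rw [map_sum, tangentCoord_sum]
  simp only [map_smul, tangentCoord_smul]

/-- No twist applied to a field with vanishing covariant derivative. `ParallelOn 0 τ` and
`IsParallel τ` agree by definition, as do `CurveOn n 0 τ` and `IsACCurve n τ`. -/
theorem IsRolling.parallelOn (h : IsRolling o o' τ x x' q) (hZ : ParallelOn 0 τ x Z) :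
    ParallelOn 0 τ x' fun t => q t (Z t) := by
  refine ⟨FieldOn.map_isometry h.curve h.curve' h.absolutelyContinuous hZ.1, ?_⟩
  filter_upwards [h.noTwist Z hZ.1, hZ.2] with t h1 h2 ht
  rw [← h1 ht, h2 ht, map_zero]

theorem IsRolling.isHorizontal (h : IsRolling o o' τ x x' q) (hf : IsHorizontal o τ x f) :
    IsHorizontal o' τ x' fun t => (f t).trans (q t) := by
  refine ⟨fun t ht => ?_, fun j => h.parallelOn (hf.parallel j)⟩
  rw [← h.oriented t ht, ← hf.oriented t ht, ← orientation_map_trans]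
  rfl

theorem IsRolling.isAntiDevelopment (h : IsRolling o o' τ x x' q) {y : ℝ → Euc n}
    (hy : IsAntiDevelopment o τ x y) : IsAntiDevelopment o' τ x' y := by
  obtain ⟨h1, h2, f, hf, hv⟩ := hy
  refine ⟨h1, h2, _, h.isHorizontal hf, ?_⟩
  filter_upwards [hv, h.noSlip] with t h3 h4 ht
  rw [h4 ht, LinearIsometryEquiv.trans_apply, h3 ht]

variable [IsContMDiffRiemannianBundle (𝓡 n) ∞ (EuclideanSpace ℝ (Fin n))
      (fun p : M => TangentSpace (𝓡 n) p)]
  [IsContMDiffRiemannianBundle (𝓡 n) ∞ (EuclideanSpace ℝ (Fin n))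
      (fun p : N => TangentSpace (𝓡 n) p)]
  {F : ∀ t : ℝ, Euc n ≃ₗᵢ[ℝ] TangentSpace (𝓡 n) (x' t)}

/-- Parallel frames along `x` and `x'` which give the velocities the same components define a
rolling. -/
theorem isRolling_of_frames (hτ : 0 ≤ τ) (hx : CurveOn n 0 τ x) (hx' : CurveOn n 0 τ x')
    (hf : ∀ j, ParallelOn 0 τ x fun t => f t (stdVec j))
    (hF : ∀ j, ParallelOn 0 τ x' fun t => F t (stdVec j)) {σ : Orientation ℝ (Euc n) (Fin n)}
    (ho : ∀ t ∈ Icc 0 τ, Orientation.map (Fin n) (f t).toLinearEquiv σ = o.at_ (x t))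
    (ho' : ∀ t ∈ Icc 0 τ, Orientation.map (Fin n) (F t).toLinearEquiv σ = o'.at_ (x' t))
    (hv : ∀ᵐ t : ℝ, t ∈ Icc 0 τ → ∃ w, f t w = velocity x t ∧ F t w = velocity x' t) :
    IsRolling o o' τ x x' fun t => (f t).symm.trans (F t) := by
  have hq : ∀ φ ∈ atlas (Euc n) M, ∀ ψ ∈ atlas (Euc n) N, ∀ c d : ℝ, c ≤ d →
      Icc c d ⊆ Icc 0 τ → (∀ t ∈ Icc c d, x t ∈ φ.source ∧ x' t ∈ ψ.source) → ∀ j : Fin n,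
        AbsolutelyContinuousOnInterval (fun t => tangentCoord ψ (x' t)
          ((f t).symm.trans (F t) (ofCoord φ (x t) (stdVec j)))) c d := by
    intro φ hφ ψ hψ c d hcd h1 hs j
    have h2 : AbsolutelyContinuousOnInterval
        (fun t => tangentCoord φ (x t) (ofCoord φ (x t) (stdVec j))) c d :=
      (AbsolutelyContinuousOnInterval.const_fun (stdVec j : Euc n) c d).congr fun t ht => by
        rw [uIcc_of_le hcd] at ht
        exact (tangentCoord_ofCoord hφ (hs t ht).1 _).symm
    have h3 := fun k => ac_inner_of_chart hφ hcd (fun t ht => (hs t ht).1)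
      (hx.2 φ hφ c d hcd h1 fun t ht => (hs t ht).1)
      ((hf k).1 φ hφ c d hcd h1 fun t ht => (hs t ht).1) h2
    refine (AbsolutelyContinuousOnInterval.finset_sum Finset.univ fun k _ =>
      (h3 k).fun_smul ((hF k).1 ψ hψ c d hcd h1 fun t ht => (hs t ht).2)).congr fun t _ => ?_
    rw [symm_trans_apply_eq_sum, tangentCoord_sum]
    simp only [tangentCoord_smul]
  -- The image of `v` has in `F` the components that `v` has in `f`; no twist follows by
  -- differentiating these common components.
  have hinner : ∀ t k (v : TangentSpace (𝓡 n) (x t)),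
      (inner ℝ (F t (stdVec k)) ((f t).symm.trans (F t) v) : ℝ) = inner ℝ (f t (stdVec k)) v := by
    intro t k v
    rw [LinearIsometryEquiv.trans_apply, LinearIsometryEquiv.inner_map_map,
      ← (f t).inner_map_map, LinearIsometryEquiv.apply_symm_apply]
  refine ⟨hx, hx', fun t ht => ?_, hq, ?_, fun Z hZ => ?_⟩
  · rw [← ho t ht, ← ho' t ht, ← orientation_map_trans]
    have h1 : (f t).toLinearEquiv.trans ((f t).symm.trans (F t)).toLinearEquiv =
        (F t).toLinearEquiv := by
      ext v
      simp
    rw [h1]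
  · filter_upwards [hv] with t h ht
    obtain ⟨w, hw, hw'⟩ := h ht
    rw [← hw, ← hw', LinearIsometryEquiv.trans_apply, LinearIsometryEquiv.symm_apply_apply]
  · have hqZ := FieldOn.map_isometry hx hx' hq hZ
    have h1 : ∀ᵐ t : ℝ, ∀ k, t ∈ Icc 0 τ →
        FieldDiffAt x (fun s => f s (stdVec k)) t ∧ FieldDiffAt x' (fun s => F s (stdVec k)) t ∧
          covDeriv x (fun s => f s (stdVec k)) t = 0 ∧
            covDeriv x' (fun s => F s (stdVec k)) t = 0 := by
      refine ae_all_iff.2 fun k => ?_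
      filter_upwards [(hf k).1.ae_fieldDiffAt hx hτ, (hF k).1.ae_fieldDiffAt hx' hτ, (hf k).2,
        (hF k).2] with t h1 h2 h3 h4 ht
      exact ⟨h1 ht, h2 ht, h3 ht, h4 ht⟩
    filter_upwards [h1, hx.ae_curveDiffAt hτ, hx'.ae_curveDiffAt hτ,
      FieldOn.ae_fieldDiffAt hZ hx hτ, hqZ.ae_fieldDiffAt hx' hτ] with t h1 h2 h3 h4 h5 ht
    refine eq_of_inner_frame (F t) fun k => ?_
    obtain ⟨h6, h7, h8, h9⟩ := h1 k ht
    have h10 := hasDerivAt_inner (h2 ht).2 h6 (h4 ht)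
    have h11 := hasDerivAt_inner (h3 ht).2 h7 (h5 ht)
    simp only [hinner] at h11
    have h12 := h10.unique h11
    rw [h8, h9, inner_zero_left, inner_zero_left, zero_add, zero_add] at h12
    rw [hinner, h12]

/-- The inverse is rebuilt from the parallel frames `q ∘ f` and `f`. This avoids checking absolute
continuity and no twist for the inverse maps directly. -/
theorem IsRolling.symm (hτ : 0 ≤ τ) (h : IsRolling o o' τ x x' q) :
    ∃ q', IsRolling o' o τ x' x q' := by
  have hx : CurveOn n 0 τ x := h.curve
  obtain ⟨f₀, -⟩ := exists_frame_of_orthonormal (n := n) (x 0) False (v := fun _ => 0) False.elim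
  obtain ⟨f, hf0, hf⟩ := exists_parallel_frame hx hτ f₀
  -- The frame need not be positively oriented: `σ` is whichever orientation of `ℝⁿ` it matches with
  -- that of `M`.
  obtain ⟨σ, hσ⟩ := (Orientation.map (Fin n) (f 0).toLinearEquiv).surjective (o.at_ (x 0))
  have ho : ∀ t ∈ Icc 0 τ, Orientation.map (Fin n) (f t).toLinearEquiv σ = o.at_ (x t) :=
    fun t ht => map_frame_orientation_eq o hx (fun j => (hf j).1) hσ ht
  refine ⟨_, isRolling_of_frames (f := fun t => (f t).trans (q t)) (F := f) hτ h.curve' hx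
    (fun j => h.parallelOn (hf j)) hf (fun t ht => ?_) ho ?_⟩
  · rw [← h.oriented t ht, ← ho t ht, ← orientation_map_trans]
    rfl
  · filter_upwards [h.noSlip] with t h1 ht
    refine ⟨(f t).symm (velocity x t), ?_, ?_⟩
    · rw [LinearIsometryEquiv.trans_apply, LinearIsometryEquiv.apply_symm_apply, h1 ht]
    · rw [LinearIsometryEquiv.apply_symm_apply]

end

end Rolling

/-! ### Existence of anti-developments, and the correspondence between rollings and
anti-developments -/

namespace Rolling

noncomputable section

theorem exists_isometry_map_stdOrientation_eq_neg {n : ℕ} (hn : n ≠ 0) :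
    ∃ L : Euc n ≃ₗᵢ[ℝ] Euc n,
      Orientation.map (Fin n) L.toLinearEquiv (stdOrientation n) = -stdOrientation n := by
  have : Nonempty (Fin n) := Fin.pos_iff_nonempty.1 (Nat.pos_of_ne_zero hn)
  let e := (EuclideanSpace.basisFun (Fin n) ℝ).adjustToOrientation (-stdOrientation n)
  refine ⟨e.repr.symm, ?_⟩
  have h : e.toBasis.orientation = -stdOrientation n :=
    OrthonormalBasis.orientation_adjustToOrientation _ _
  rw [← h, stdOrientation, ← Module.Basis.orientation_map]
  congr 1

section Single

variable {n : ℕ} {M : Type*} [TopologicalSpace M] [ChartedSpace (Euc n) M]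
  [IsManifold (𝓡 n) ∞ M] [RiemannianBundle (fun p : M => TangentSpace (𝓡 n) p)]
  [IsContMDiffRiemannianBundle (𝓡 n) ∞ (EuclideanSpace ℝ (Fin n))
      (fun p : M => TangentSpace (𝓡 n) p)]
  {x : ℝ → M} {τ : ℝ} {o : ManifoldOrientation n M}

theorem exists_isAntiDevelopment_of_frame (hτ : 0 ≤ τ) (hx : CurveOn n 0 τ x)
    {f₀ : Euc n ≃ₗᵢ[ℝ] TangentSpace (𝓡 n) (x 0)}
    (h₀ : Orientation.map (Fin n) f₀.toLinearEquiv (stdOrientation n) = o.at_ (x 0)) :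
    ∃ y, IsAntiDevelopment o τ x y := by
  obtain ⟨f, rfl, hf⟩ := exists_parallel_frame hx hτ f₀
  obtain ⟨y, hy, hy0, hv⟩ := exists_antiDevelopment_of_frame hx hτ fun j => (hf j).1
  exact ⟨y, hy, hy0, f,
    ⟨fun t ht => map_frame_orientation_eq o hx (fun j => (hf j).1) h₀ ht, hf⟩, hv⟩

/-- An anti-development exists unless `n = 0` and the frames of `M` are negatively oriented. -/
theorem exists_isAntiDevelopment_or (hτ : 0 ≤ τ) (hx : CurveOn n 0 τ x) :
    (∃ y, IsAntiDevelopment o τ x y) ∨ n = 0 ∧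
      ∃ f : ∀ t : ℝ, Euc n ≃ₗᵢ[ℝ] TangentSpace (𝓡 n) (x t),
        (∀ j, ParallelOn 0 τ x fun t => f t (stdVec j)) ∧ ∀ t ∈ Icc 0 τ,
          Orientation.map (Fin n) (f t).toLinearEquiv (-stdOrientation n) = o.at_ (x t) := by
  obtain ⟨f₀, -⟩ := exists_frame_of_orthonormal (n := n) (x 0) False (v := fun _ => 0) False.elim
  obtain ⟨σ, hσ⟩ := (Orientation.map (Fin n) f₀.toLinearEquiv).surjective (o.at_ (x 0))
  rcases Orientation.eq_or_eq_neg σ (stdOrientation n) (by simp) with rfl | rfl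
  · exact Or.inl (exists_isAntiDevelopment_of_frame hτ hx hσ)
  -- In positive dimension a reflection of the initial frame corrects the orientation; in dimension
  -- 0 no isometry can.
  by_cases hn : n = 0
  · obtain ⟨f, rfl, hf⟩ := exists_parallel_frame hx hτ f₀
    exact Or.inr ⟨hn, f, hf,
      fun t ht => map_frame_orientation_eq o hx (fun j => (hf j).1) hσ ht⟩
  · obtain ⟨L, hL⟩ := exists_isometry_map_stdOrientation_eq_neg hn
    refine Or.inl (exists_isAntiDevelopment_of_frame (f₀ := L.trans f₀) hτ hx ?_)
    rw [← hσ, ← hL, ← orientation_map_trans]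
    rfl

end Single

section Pair

variable {n : ℕ} {M : Type*} [TopologicalSpace M] [ChartedSpace (Euc n) M]
  [IsManifold (𝓡 n) ∞ M] [RiemannianBundle (fun p : M => TangentSpace (𝓡 n) p)]
  [IsContMDiffRiemannianBundle (𝓡 n) ∞ (EuclideanSpace ℝ (Fin n))
      (fun p : M => TangentSpace (𝓡 n) p)]
  {N : Type*} [TopologicalSpace N] [ChartedSpace (Euc n) N]
  [IsManifold (𝓡 n) ∞ N] [RiemannianBundle (fun p : N => TangentSpace (𝓡 n) p)]
  [IsContMDiffRiemannianBundle (𝓡 n) ∞ (EuclideanSpace ℝ (Fin n))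
      (fun p : N => TangentSpace (𝓡 n) p)]
  {x : ℝ → M} {x' : ℝ → N} {τ : ℝ}
  {q : ∀ t : ℝ, TangentSpace (𝓡 n) (x t) ≃ₗᵢ[ℝ] TangentSpace (𝓡 n) (x' t)}
  {o : ManifoldOrientation n M} {o' : ManifoldOrientation n N} {y y' : ℝ → Euc n}

-- Both `q ∘ f` and `f'` are horizontal over `x'`, so they differ by a constant rotation `L`.
-- Comparing velocities shows that `y' - L y` has zero derivative almost everywhere, and it starts
-- at 0.
omit [IsContMDiffRiemannianBundle (𝓡 n) ∞ (EuclideanSpace ℝ (Fin n))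
      (fun p : M => TangentSpace (𝓡 n) p)] in
theorem IsRolling.exists_specialOrthogonal (hτ : 0 ≤ τ) (h : IsRolling o o' τ x x' q)
    (hy : IsAntiDevelopment o τ x y) (hy' : IsAntiDevelopment o' τ x' y') :
    ∃ ι ∈ Matrix.specialOrthogonalGroup (Fin n) ℝ,
      ∀ t ∈ Icc 0 τ, y' t = Matrix.toEuclideanLin ι (y t) := by
  obtain ⟨hac, h0, f, hf, hv⟩ := hy
  obtain ⟨hac', h0', f', hf', hv'⟩ := hy'
  have hg := h.isHorizontal hf
  have hmem : (0 : ℝ) ∈ Icc 0 τ := ⟨le_rfl, hτ⟩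
  have heq := fun t ht => parallel_frame_eq (t := t) h.curve' hτ hf'.parallel hg.parallel ht
  set L := ((f 0).trans (q 0)).trans (f' 0).symm
  have hL : Orientation.map (Fin n) L.toLinearEquiv (stdOrientation n) = stdOrientation n := by
    refine (Orientation.map (Fin n) (f' 0).toLinearEquiv).injective ?_
    rw [hf'.oriented 0 hmem, ← hg.oriented 0 hmem, ← orientation_map_trans]
    have h1 : L.toLinearEquiv.trans (f' 0).toLinearEquiv = ((f 0).trans (q 0)).toLinearEquiv := by
      ext v
      simp [L]
    rw [h1]
  obtain ⟨ι, hι, hιL⟩ := exists_mem_specialOrthogonalGroup L hL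
  refine ⟨ι, hι, fun t ht => ?_⟩
  have hLac : AbsolutelyContinuousOnInterval (fun t => L (y t)) 0 τ :=
    hac.clm_comp (L.toContinuousLinearEquiv : Euc n →L[ℝ] Euc n)
  have h1 := (hac'.fun_sub hLac).eq_of_ae_hasDerivAt_zero hτ ?_ ht
  · rw [hιL]
    simpa [h0, h0', sub_eq_zero] using h1
  · filter_upwards [hv, hv', h.noSlip, hac.ae_differentiableAt_euclidean,
      hac'.ae_differentiableAt_euclidean] with t h1 h2 h3 h4 h5 ht
    rw [uIcc_of_le hτ] at h4 h5
    have h6 := (h5 ht).hasDerivAt.sub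
      ((L.toContinuousLinearEquiv : Euc n →L[ℝ] Euc n).hasFDerivAt.comp_hasDerivAt t
        (h4 ht).hasDerivAt)
    have h7 : deriv y' t = L (deriv y t) := by
      refine (f' t).injective ?_
      rw [h2 ht, h3 ht, ← h1 ht]
      exact congrArg (fun A : Euc n ≃ₗᵢ[ℝ] _ => A (deriv y t)) (heq t ht)
    rw [h7] at h6
    have h8 : L (deriv y t) - (L.toContinuousLinearEquiv : Euc n →L[ℝ] Euc n) (deriv y t) = 0 :=
      sub_self _
    rw [h8] at h6
    exact h6

/-- The rotated frame `f' ∘ ι` is still parallel and positively oriented, and it reads the velocity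
of `x'` as the derivative of `y`, just as `f` does for `x`. -/
theorem exists_isRolling_of_specialOrthogonal (hτ : 0 ≤ τ) (hx : CurveOn n 0 τ x)
    (hx' : CurveOn n 0 τ x') (hy : IsAntiDevelopment o τ x y) (hy' : IsAntiDevelopment o' τ x' y')
    {ι : Matrix (Fin n) (Fin n) ℝ} (hι : ι ∈ Matrix.specialOrthogonalGroup (Fin n) ℝ)
    (h : ∀ t ∈ Icc 0 τ, y' t = Matrix.toEuclideanLin ι (y t)) : ∃ q, IsRolling o o' τ x x' q := by
  obtain ⟨hac, -, f, hf, hv⟩ := hy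
  obtain ⟨-, -, f', hf', hv'⟩ := hy'
  obtain ⟨L, hL, hLo⟩ := exists_isometry_of_mem_specialOrthogonalGroup hι
  refine ⟨_, isRolling_of_frames (F := fun t => L.trans (f' t)) hτ hx hx' hf.parallel
    (parallelOn_frame_comp hx' hτ hf'.parallel L) hf.oriented (fun t ht => ?_) ?_⟩
  · rw [← hf'.oriented t ht]
    conv_rhs => rw [← hLo, ← orientation_map_trans]
    rfl
  · filter_upwards [hv, hv', hac.ae_differentiableAt_euclidean, ae_mem_Ioo 0 τ]
      with t h1 h2 h3 h4 ht
    refine ⟨_, h1 ht, ?_⟩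
    rw [uIcc_of_le hτ] at h3
    have h5 : HasDerivAt y' (L (deriv y t)) t := by
      refine ((L.toContinuousLinearEquiv : Euc n →L[ℝ] Euc n).hasFDerivAt.comp_hasDerivAt t
        (h3 ht).hasDerivAt).congr_of_eventuallyEq ?_
      filter_upwards [Icc_mem_nhds (h4 ht).1 (h4 ht).2] with s hs
      rw [h s hs, ← hL]
      rfl
    rw [LinearIsometryEquiv.trans_apply, ← h5.deriv, h2 ht]

/-- A common anti-development gives a rolling with the identity rotation. If there is none, then `n
= 0` and both curves carry frames matching the reversed orientation; these roll because all tangent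
vectors vanish. -/
theorem exists_isRolling_of_antiDevelopments_eq (hτ : 0 ≤ τ) (hx : CurveOn n 0 τ x)
    (hx' : CurveOn n 0 τ x') (h : ∀ y, IsAntiDevelopment o τ x y ↔ IsAntiDevelopment o' τ x' y) :
    ∃ q, IsRolling o o' τ x x' q := by
  have key : ∀ y, IsAntiDevelopment o τ x y → ∃ q, IsRolling o o' τ x x' q := fun y hy =>
    exists_isRolling_of_specialOrthogonal hτ hx hx' hy ((h y).1 hy) (one_mem _) fun t _ => by simp
  rcases exists_isAntiDevelopment_or (o := o) hτ hx with ⟨y, hy⟩ | ⟨rfl, f, hf, ho⟩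
  · exact key y hy
  rcases exists_isAntiDevelopment_or (o := o') hτ hx' with ⟨y, hy⟩ | ⟨-, f', hf', ho'⟩
  · exact key y ((h y).2 hy)
  refine ⟨_, isRolling_of_frames hτ hx hx' hf hf' ho ho' (.of_forall fun t _ => ⟨0, ?_, ?_⟩)⟩
  · exact (f t).symm.injective (Subsingleton.elim _ _)
  · exact (f' t).symm.injective (Subsingleton.elim _ _)

end Pair

end

end Rolling

/-! ### The main theorem -/

theorem theorem3p3 {n : ℕ}
    {M : Type*} [TopologicalSpace M] [T2Space M] [SecondCountableTopology M] [ConnectedSpace M]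
    [ChartedSpace (EuclideanSpace ℝ (Fin n)) M] [IsManifold (𝓡 n) ∞ M]
    [RiemannianBundle (fun p : M => TangentSpace (𝓡 n) p)]
    [IsContMDiffRiemannianBundle (𝓡 n) ∞ (EuclideanSpace ℝ (Fin n))
      (fun p : M => TangentSpace (𝓡 n) p)]
    {N : Type*} [TopologicalSpace N] [T2Space N] [SecondCountableTopology N] [ConnectedSpace N]
    [ChartedSpace (EuclideanSpace ℝ (Fin n)) N] [IsManifold (𝓡 n) ∞ N]
    [RiemannianBundle (fun p : N => TangentSpace (𝓡 n) p)]
    [IsContMDiffRiemannianBundle (𝓡 n) ∞ (EuclideanSpace ℝ (Fin n))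
      (fun p : N => TangentSpace (𝓡 n) p)]
    (o : Rolling.ManifoldOrientation n M) (o' : Rolling.ManifoldOrientation n N)
    (τ : ℝ) (hτ : 0 < τ) (x : ℝ → M) (x' : ℝ → N)
    (hx : Rolling.IsACCurve n τ x) (hx' : Rolling.IsACCurve n τ x') :
    (∀ y y' : ℝ → EuclideanSpace ℝ (Fin n),
      Rolling.IsAntiDevelopment o τ x y → Rolling.IsAntiDevelopment o' τ x' y' →
        ((∃ q, Rolling.IsRolling o o' τ x x' q) ↔
          ∃ ι ∈ Matrix.specialOrthogonalGroup (Fin n) ℝ,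
            ∀ t ∈ Set.Icc 0 τ, y' t = Matrix.toEuclideanLin ι (y t))) ∧
    ((∃ q, Rolling.IsRolling o o' τ x x' q) ↔
      {y | Rolling.IsAntiDevelopment o τ x y} = {y' | Rolling.IsAntiDevelopment o' τ x' y'}) := by
  refine ⟨fun y y' hy hy' => ⟨?_, ?_⟩, ?_, fun h => ?_⟩
  · rintro ⟨q, hq⟩
    exact hq.exists_specialOrthogonal hτ.le hy hy'
  · rintro ⟨ι, hι, h⟩
    exact Rolling.exists_isRolling_of_specialOrthogonal hτ.le hx hx' hy hy' hι h
  · rintro ⟨q, hq⟩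
    obtain ⟨q', hq'⟩ := hq.symm hτ.le
    exact Set.ext fun y => ⟨hq.isAntiDevelopment, hq'.isAntiDevelopment⟩
  · exact Rolling.exists_isRolling_of_antiDevelopments_eq hτ.le hx hx' (Set.ext_iff.1 h)
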